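/- Let $G$ be a finitely generated group. For a finite generating set $S$ and a non-empty set $X$ with a $G$-action, let $\mathrm{vol}_{G,X}(n)$ be the maximal cardinality of a ball of radius $n$ in the Schreier graph of the action (the graph with vertex set $X$ and edges joining $x$ to $sx$ for $x\in X$, $s\in S$). Say that $G$ has a Schreier growth gap $f(n)$ if for every faithful $G$-set $X$ (and every $S$) there is an integer $C>0$ with $f(n)\le C\,\mathrm{vol}_{G,X}(Cn)$ for all large $n$. A subset $\mathcal L\subseteq G$ is non-foldable if for every faithful $G$-set $X$ and every finite $\Sigma\subseteq\mathcal L$ there is $x\in X$ such that $g\mapsto gx$ is injective on $\Sigma$. Let $H_3(\mathbb Z)$ be the Heisenberg group of upper unitriangular $3\times 3$ integer matrices. (i) If $G$ is polycyclic and not virtually nilpotent, then $G$ has a Schreier growth gap $\exp(n)$. (ii) If $G$ is finitely generated, virtually nilpotent and not virtually abelian, then $G$ contains a subgroup isomorphic to $H_3(\mathbb Z)$, every such subgroup is a non-foldable subset of $G$, and $G$ has a Schreier growth gap $n^4$. -/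

import Mathlib

open scoped Pointwise

universe u w

/-! ## Growth of group actions -/

/-- The Schreier graph of the action of `G` on `X` with respect to a set `S ⊆ G`: the vertex set is
`X`, and `x` is joined to `s • x` for `x : X` and `s ∈ S`.  Orientations, multiplicities and loops
are forgotten, since they do not affect the simplicial distance. -/
def schreierGraph {G : Type*} [Group G] (S : Set G) (X : Type*) [MulAction G X] : SimpleGraph X :=
  SimpleGraph.fromRel fun x y => ∃ s ∈ S, y = s • x

/-- The ball of radius `n` around `x` in the Schreier graph. -/
def schreierBall {G : Type*} [Group G] (S : Set G) {X : Type*} [MulAction G X] (x : X) (n : ℕ) :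
    Set X :=
  {y | (schreierGraph S X).edist x y ≤ n}

/-- The growth `n ↦ max_{x ∈ X} |B_x(n)|` of the action of `G` on `X` with respect to `S`.
For finite `S` and nonempty `X` the maximum exists: see `isGreatest_actionGrowth`. -/
noncomputable def actionGrowth {G : Type*} [Group G] (S : Set G) (X : Type*) [MulAction G X]
    (n : ℕ) : ℕ :=
  sSup (Set.range fun x : X => (schreierBall S x n).ncard)

/-- The ball of radius `n` around `x` is `Tⁿ • x`, where `T = {1} ∪ S ∪ S⁻¹`. -/
theorem schreierBall_eq_image {G : Type*} [Group G] (S : Set G) {X : Type*} [MulAction G X]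
    (x : X) (n : ℕ) :
    schreierBall S x n = (fun g : G => g • x) '' ((insert 1 (S ∪ S⁻¹)) ^ n) := by
  have adj_iff : ∀ a b : X, (schreierGraph S X).Adj a b ↔
      a ≠ b ∧ ∃ s ∈ S ∪ S⁻¹, b = s • a := by
    intro a b
    rw [schreierGraph, SimpleGraph.fromRel_adj]
    constructor
    · rintro ⟨h, ⟨s, hs, rfl⟩ | ⟨s, hs, rfl⟩⟩
      · exact ⟨h, s, Or.inl hs, rfl⟩
      · exact ⟨h, s⁻¹, Or.inr (by simpa using hs), by simp⟩
    · rintro ⟨h, s, hs | hs, rfl⟩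
      · exact ⟨h, Or.inl ⟨s, hs, rfl⟩⟩
      · exact ⟨h, Or.inr ⟨s⁻¹, hs, by simp⟩⟩
  have one_mem : ∀ k : ℕ, (1 : G) ∈ (insert 1 (S ∪ S⁻¹) : Set G) ^ k := fun k =>
    Set.one_mem_pow (Set.mem_insert _ _)
  have walk_mem : ∀ (a b : X) (w : (schreierGraph S X).Walk a b),
      ∃ g ∈ (insert 1 (S ∪ S⁻¹) : Set G) ^ w.length, b = g • a := by
    intro a b w
    induction w with
    | nil => exact ⟨1, one_mem _, by simp⟩
    | cons h w ih =>
      obtain ⟨g, hg, rfl⟩ := ih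
      obtain ⟨-, s, hs, rfl⟩ := (adj_iff _ _).1 h
      refine ⟨g * s, ?_, by rw [mul_smul]⟩
      rw [SimpleGraph.Walk.length_cons, pow_succ]
      exact Set.mul_mem_mul hg (Set.mem_insert_of_mem _ hs)
  ext y
  constructor
  · intro h
    have hne : (schreierGraph S X).edist x y ≠ ⊤ := ne_top_of_le_ne_top (ENat.natCast_ne_top n) h
    obtain ⟨w, hw⟩ := SimpleGraph.exists_walk_of_edist_ne_top hne
    obtain ⟨g, hg, rfl⟩ := walk_mem _ _ w
    have hn : w.length ≤ n := by
      have h' : (schreierGraph S X).edist x (g • x) ≤ n := h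
      rw [← hw] at h'
      exact_mod_cast h'
    exact ⟨g, Set.pow_subset_pow_right (Set.mem_insert _ _) hn hg, rfl⟩
  · rintro ⟨g, hg, rfl⟩
    change (schreierGraph S X).edist x (g • x) ≤ n
    induction n generalizing x g with
    | zero =>
      have : g = 1 := by simpa using hg
      simp [this]
    | succ n ih =>
      rw [pow_succ] at hg
      obtain ⟨a, ha, t, ht, rfl⟩ := hg
      have h1 := ih (t • x) a ha
      have h2 : (schreierGraph S X).edist x (t • x) ≤ 1 := by
        rw [SimpleGraph.edist_le_one_iff_adj_or_eq]
        by_cases hx : x = t • x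
        · exact Or.inr hx
        · rcases ht with rfl | ht
          · exact absurd (one_smul G x).symm hx
          · exact Or.inl ((adj_iff _ _).2 ⟨hx, t, ht, rfl⟩)
      have h3 := (schreierGraph S X).edist_triangle (u := x) (v := t • x) (w := a • t • x)
      simp only [mul_smul]
      refine h3.trans ((add_le_add h2 h1).trans ?_)
      push_cast
      rw [add_comm]

/-- For finite `S` and nonempty `X` the growth function is a genuine maximum. -/
theorem isGreatest_actionGrowth {G : Type*} [Group G] {S : Set G} (hS : S.Finite) (X : Type*)
    [MulAction G X] [Nonempty X] (n : ℕ) :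
    IsGreatest (Set.range fun x : X => (schreierBall S x n).ncard) (actionGrowth S X n) := by
  have hT : ((insert 1 (S ∪ S⁻¹) : Set G) ^ n).Finite := by
    induction n with
    | zero => simp
    | succ n ih => rw [pow_succ]; exact ih.mul ((hS.union hS.inv).insert 1)
  have hb : BddAbove (Set.range fun x : X => (schreierBall S x n).ncard) := by
    refine ⟨((insert 1 (S ∪ S⁻¹) : Set G) ^ n).ncard, ?_⟩
    rintro _ ⟨x, rfl⟩
    change (schreierBall S x n).ncard ≤ _
    rw [schreierBall_eq_image]
    exact Set.ncard_image_le hT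
  exact ⟨Nat.sSup_mem (Set.range_nonempty _) hb, fun _ h => le_csSup hb h⟩

/-- `f ≼ g`: there is a constant `C > 0` with `f n ≤ C * g (C * n)` for all large `n`. -/
def GrowthLE (f g : ℕ → ℝ) : Prop :=
  ∃ C : ℕ, 0 < C ∧ ∀ᶠ n in Filter.atTop, f n ≤ C * g (C * n)

/-- A finitely generated group `G` has a Schreier growth gap `f` if the growth of the action of `G`
on every faithful (nonempty) `G`-set is `≽ f`, with respect to every finite generating set. -/
def HasSchreierGrowthGap (G : Type u) [Group G] (f : ℕ → ℝ) : Prop :=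
  Group.FG G ∧
    ∀ (X : Type w) [Nonempty X] [MulAction G X] [FaithfulSMul G X] (S : Set G),
      S.Finite → Subgroup.closure S = ⊤ → GrowthLE f fun n => (actionGrowth S X n : ℝ)

/-! ## Non-foldable subsets -/

/-- `L ⊆ G` is non-folded in the `G`-set `X` if for every finite `Σ ⊆ L` some orbital map
`g ↦ g • x` is injective on `Σ`. -/
def IsNonFoldedIn {G : Type*} [Group G] (L : Set G) (X : Type*) [MulAction G X] : Prop :=
  ∀ F : Set G, F.Finite → F ⊆ L → ∃ x : X, Set.InjOn (fun g : G => g • x) F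

/-- `L ⊆ G` is non-foldable if it is non-folded in every faithful (nonempty) `G`-set. -/
def IsNonFoldable {G : Type u} [Group G] (L : Set G) : Prop :=
  ∀ (X : Type w) [Nonempty X] [MulAction G X] [FaithfulSMul G X], IsNonFoldedIn L X

/-! ## Classes of groups -/

/-- `G` is polycyclic if it has a finite subnormal series
`1 = H 0 ≤ H 1 ≤ ⋯ ≤ H n = G` with cyclic factors. -/
def IsPolycyclic (G : Type*) [Group G] : Prop :=
  ∃ (n : ℕ) (H : ℕ → Subgroup G), H 0 = ⊥ ∧ H n = ⊤ ∧
    ∀ i < n, H i ≤ H (i + 1) ∧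
      ∃ _ : ((H i).subgroupOf (H (i + 1))).Normal,
        IsCyclic (H (i + 1) ⧸ (H i).subgroupOf (H (i + 1)))

/-- `G` is virtually abelian if it has an abelian subgroup of finite index. -/
def IsVirtuallyAbelian (G : Type*) [Group G] : Prop :=
  ∃ A : Subgroup G, IsMulCommutative A ∧ A.FiniteIndex

/-- The Heisenberg group `H₃(ℤ)` of upper unitriangular `3 × 3` integer matrices. -/
def heisenbergGroup : Subgroup (Matrix.SpecialLinearGroup (Fin 3) ℤ) where
  carrier := {A | (∀ i, A i i = 1) ∧ ∀ i j, j < i → A i j = 0}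
  one_mem' := by
    refine ⟨fun i => by simp, fun i j h => by simp [h.ne']⟩
  mul_mem' := by
    rintro A B ⟨hA1, hA0⟩ ⟨hB1, hB0⟩
    have a10 := hA0 1 0 (by decide)
    have a20 := hA0 2 0 (by decide)
    have a21 := hA0 2 1 (by decide)
    have b10 := hB0 1 0 (by decide)
    have b20 := hB0 2 0 (by decide)
    have b21 := hB0 2 1 (by decide)
    refine ⟨fun i => ?_, fun i j h => ?_⟩
    · fin_cases i <;>
        simp [Matrix.mul_apply, Fin.sum_univ_three, hA1, hB1, a10, a20, a21, b10, b20, b21]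
    · fin_cases i <;> fin_cases j <;>
        simp_all [Matrix.mul_apply, Fin.sum_univ_three]
  inv_mem' := by
    rintro A ⟨hA1, hA0⟩
    have a10 := hA0 1 0 (by decide)
    have a20 := hA0 2 0 (by decide)
    have a21 := hA0 2 1 (by decide)
    refine ⟨fun i => ?_, fun i j h => ?_⟩
    · fin_cases i <;>
        simp [Matrix.SpecialLinearGroup.coe_inv, Matrix.adjugate_fin_three, hA1, a10, a20, a21]
    · fin_cases i <;> fin_cases j <;>
        simp_all [Matrix.SpecialLinearGroup.coe_inv, Matrix.adjugate_fin_three]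

/-! ## Comparing orbits with balls -/

/-! Both growth gaps come from one mechanism. If the orbital map at some `x` is injective on a set
of `f n` elements inside `B ^ n`, then some ball of radius `O(n)` has at least `f n` points.
Injectivity on `F` means that `x` is fixed by none of the finitely many quotients `g⁻¹ * h` with `g
≠ h` in `F`. So the question is whether a finite set `P` of such quotients can have fixed points
covering a faithful `X`. If it does, apply the covering to the translates of `x`: the stabilizer of
`x` meets every conjugate of `P`. By pigeonhole one `p ∈ P` serves two different conjugators, so the
stabilizer contains two conjugates of the same element.

In the Heisenberg group the quotient of two such conjugates is central, and the conjugators can be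
chosen so that it is nontrivial with bounded exponent. One central element then acts trivially,
against faithfulness (`exists_forall_smul_ne_of_heisenbergGroup`). Balls of `H₃(ℤ)` have about `n ^
4` elements. Heisenberg subgroups exist because a finitely generated nilpotent group whose central
commutators `⁅x, y⁆`, with `y` in the second center, are all torsion has a center of finite index.

In the polycyclic case the Heisenberg group is replaced by a nilpotent subgroup `M` with a
homomorphism `ℓ : M → ℂ` that conjugation by some `t` multiplies by `μ`, `‖μ‖ > 1`. If there were
none, Kronecker's theorem would make a power of `t` act unipotently, and the group would be
virtually nilpotent (`IsPolycyclic.exists_isEigenHom`). Taking `M` of minimal Hirsch length makes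
`ℓ` irreducible. The pigeonhole step then enlarges the subgroups of `M` known to lie in stabilizers
until they have finite index (`IsIrreducibleEigenHom.exists_forall_smul_ne`). The sums `∑ εᵢ μ ^ i`
with binary digits `εᵢ` supply `2 ^ n` elements separated by `ℓ`. -/

theorem Set.Finite.group_pow {G : Type*} [Group G] {B : Set G} (hB : B.Finite) (n : ℕ) :
    (B ^ n).Finite := by
  induction n with
  | zero => simp
  | succ n ih => rw [pow_succ]; exact ih.mul hB

/-- Every finite set lies in a power of `{1} ∪ S ∪ S⁻¹` when `S` generates. -/
theorem exists_subset_pow_of_closure_eq_top {G : Type*} [Group G] {S : Set G}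
    (hS : Subgroup.closure S = ⊤) {B : Set G} (hB : B.Finite) :
    ∃ r : ℕ, 0 < r ∧ B ⊆ (insert 1 (S ∪ S⁻¹) : Set G) ^ r := by
  set T : Set G := insert 1 (S ∪ S⁻¹) with hT
  have h1 : (1 : G) ∈ T := Set.mem_insert _ _
  have hTi : T⁻¹ = T := by
    rw [hT, Set.inv_insert, inv_one, Set.union_inv, inv_inv, Set.union_comm]
  have key : ∀ g : G, ∃ r : ℕ, g ∈ T ^ r := by
    intro g
    have hg : g ∈ Subgroup.closure S := hS ▸ Subgroup.mem_top g
    induction hg using Subgroup.closure_induction with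
    | mem x hx => exact ⟨1, by rw [pow_one]; exact Or.inr (Or.inl hx)⟩
    | one => exact ⟨0, by simp⟩
    | mul x y _ _ hx hy =>
      obtain ⟨a, ha⟩ := hx
      obtain ⟨b, hb⟩ := hy
      exact ⟨a + b, by rw [pow_add]; exact Set.mul_mem_mul ha hb⟩
    | inv x _ hx =>
      obtain ⟨a, ha⟩ := hx
      refine ⟨a, ?_⟩
      rw [← Set.inv_mem_inv, ← inv_pow, hTi, inv_inv]
      exact ha
  choose r hr using key
  obtain ⟨N, hN⟩ := (hB.image r).bddAbove
  refine ⟨N + 1, N.succ_pos, fun g hg => ?_⟩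
  exact Set.pow_subset_pow_right h1 ((hN ⟨g, hg, rfl⟩).trans N.le_succ) (hr g)

/-- If the `n`-th power of a fixed finite set has, for each `n`, an orbital image with at least
`f n` elements, then the growth of the action is at least `f`, after rescaling. -/
theorem exists_le_actionGrowth {G : Type*} [Group G] {X : Type*} [MulAction G X] [Nonempty X]
    {S : Set G} (hSf : S.Finite) (hS : Subgroup.closure S = ⊤) {B : Set G} (hB : B.Finite)
    {f : ℕ → ℕ} (hf : ∀ n, ∃ x : X, f n ≤ ((fun g : G => g • x) '' B ^ n).ncard) :
    ∃ r : ℕ, 0 < r ∧ ∀ n, f n ≤ actionGrowth S X (r * n) := by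
  obtain ⟨r, hr0, hr⟩ := exists_subset_pow_of_closure_eq_top hS hB
  refine ⟨r, hr0, fun n => ?_⟩
  obtain ⟨x, hx⟩ := hf n
  have hT : ((insert 1 (S ∪ S⁻¹) : Set G) ^ (r * n)).Finite :=
    Set.Finite.group_pow ((hSf.union hSf.inv).insert 1) _
  refine hx.trans (le_trans ?_ ((isGreatest_actionGrowth hSf X (r * n)).2 ⟨x, rfl⟩))
  change _ ≤ (schreierBall S x (r * n)).ncard
  rw [schreierBall_eq_image]
  refine Set.ncard_le_ncard (Set.image_mono ?_) (hT.image _)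
  rw [pow_mul]
  exact Set.pow_subset_pow_left hr

/-! ## The Heisenberg group in coordinates -/

/-- The unitriangular matrix with entries `a`, `b` above the diagonal and `c` in the corner. -/
def heis (a b c : ℤ) : heisenbergGroup :=
  ⟨⟨!![1, a, c; 0, 1, b; 0, 0, 1], by simp [Matrix.det_fin_three]⟩, by
    refine ⟨fun i => ?_, fun i j h => ?_⟩
    · fin_cases i <;> simp
    · fin_cases i <;> fin_cases j <;> simp_all⟩

theorem heis_mul (a b c a' b' c' : ℤ) :
    heis a b c * heis a' b' c' = heis (a + a') (b + b') (c + c' + a * b') := by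
  apply Subtype.ext
  apply Subtype.ext
  change !![1, a, c; 0, 1, b; 0, 0, 1] * !![1, a', c'; 0, 1, b'; 0, 0, 1] =
    (!![1, a + a', c + c' + a * b'; 0, 1, b + b'; 0, 0, 1] : Matrix (Fin 3) (Fin 3) ℤ)
  ext i j
  fin_cases i <;> fin_cases j <;>
    simp [Matrix.mul_apply, Fin.sum_univ_three] <;> ring

theorem heis_inj {a b c a' b' c' : ℤ} :
    heis a b c = heis a' b' c' ↔ a = a' ∧ b = b' ∧ c = c' := by
  constructor
  · intro h
    have h' := fun i j => congrArg (fun A : heisenbergGroup => A.1.1 i j) h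
    have h1 := h' 0 1
    have h2 := h' 1 2
    have h3 := h' 0 2
    simp [heis] at h1 h2 h3
    exact ⟨h1, h2, h3⟩
  · rintro ⟨rfl, rfl, rfl⟩
    rfl

theorem heis_zero : heis 0 0 0 = 1 := by
  have := heis_mul 0 0 0 0 0 0
  simpa using this

theorem heis_inv (a b c : ℤ) : (heis a b c)⁻¹ = heis (-a) (-b) (a * b - c) := by
  rw [inv_eq_iff_mul_eq_one, heis_mul, ← heis_zero, heis_inj]
  refine ⟨by ring, by ring, by ring⟩

theorem exists_eq_heis (A : heisenbergGroup) : ∃ a b c, A = heis a b c := by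
  obtain ⟨A, h1, h0⟩ := A
  refine ⟨A 0 1, A 1 2, A 0 2, ?_⟩
  apply Subtype.ext
  apply Subtype.ext
  ext i j
  have a10 := h0 1 0 (by decide)
  have a20 := h0 2 0 (by decide)
  have a21 := h0 2 1 (by decide)
  have a00 := h1 0
  have a11 := h1 1
  have a22 := h1 2
  fin_cases i <;> fin_cases j <;> simp_all [heis]

theorem heis_pow_x (a : ℤ) (n : ℕ) : heis a 0 0 ^ n = heis (n * a) 0 0 := by
  induction n with
  | zero => simp [heis_zero]
  | succ n ih => rw [pow_succ, ih, heis_mul, heis_inj]; simp [add_mul]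

theorem heis_pow_y (b : ℤ) (n : ℕ) : heis 0 b 0 ^ n = heis 0 (n * b) 0 := by
  induction n with
  | zero => simp [heis_zero]
  | succ n ih => rw [pow_succ, ih, heis_mul, heis_inj]; simp [add_mul]

theorem heis_pow_z (c : ℤ) (n : ℕ) : heis 0 0 c ^ n = heis 0 0 (n * c) := by
  induction n with
  | zero => simp [heis_zero]
  | succ n ih => rw [pow_succ, ih, heis_mul, heis_inj]; simp [add_mul]

/-- A finite set of nontrivial elements of the Heisenberg group does not cover a faithful action by
its fixed points. -/
theorem exists_forall_smul_ne_of_heisenbergGroup {X : Type*} [MulAction heisenbergGroup X]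
    [FaithfulSMul heisenbergGroup X] {P : Set heisenbergGroup} (hP : P.Finite) (h1 : 1 ∉ P) :
    ∃ x : X, ∀ p ∈ P, p • x ≠ x := by
  by_contra! hcon
  have hbound : ∃ L : ℤ, ∀ p ∈ P, ∀ a b c, p = heis a b c → |a| < L ∧ |b| < L ∧ |c| < L := by
    obtain ⟨L, hL⟩ := (hP.image fun p : heisenbergGroup =>
      |p.1.1 0 1| + |p.1.1 1 2| + |p.1.1 0 2|).bddAbove
    refine ⟨L + 1, fun p hp a b c h => ?_⟩
    have := hL ⟨p, hp, rfl⟩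
    simp only [h] at this
    simp [heis] at this
    have := abs_nonneg a
    have := abs_nonneg b
    have := abs_nonneg c
    omega
  obtain ⟨L, hL⟩ := hbound
  -- every stabilizer contains a central element with bounded exponent
  have key : ∀ x : X, ∃ c : ℤ, c ≠ 0 ∧ |c| < L + P.ncard * (L + L * L) ∧ heis 0 0 c • x = x := by
    intro x
    -- Conjugation by `heis i (L * i) 0` shifts the corner of `heis a b c` by a multiple of `b - L *
    -- a`. The slope `L` exceeds all entries of `P`, so this number vanishes only for central
    -- elements.
    have hx : ∀ i : ℕ, ∃ p ∈ P, p • (heis i (L * i) 0 • x) = heis i (L * i) 0 • x :=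
      fun i => hcon _
    choose p hpP hp using hx
    obtain ⟨i, hi, j, hj, hij, hpij⟩ : ∃ i ∈ Finset.range (P.ncard + 1),
        ∃ j ∈ Finset.range (P.ncard + 1), i ≠ j ∧ p i = p j := by
      refine Finset.exists_ne_map_eq_of_card_lt_of_maps_to (t := hP.toFinset) ?_ ?_
      · rw [← Set.ncard_eq_toFinset_card P hP]; simp
      · intro i _; simpa using hpP i
    obtain ⟨a, b, c, habc⟩ := exists_eq_heis (p i)
    obtain ⟨ha, hb, hc⟩ := hL _ (hpP i) a b c habc
    have hL0 : 0 < L := (abs_nonneg a).trans_lt ha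
    have hi' := hp i
    have hj' := hp j
    rw [← hpij] at hj'
    rw [habc] at hi' hj'
    have conj : ∀ k : ℤ, heis a b c • (heis k (L * k) 0 • x) = heis k (L * k) 0 • x →
        heis a b (c - k * (b - L * a)) • x = x := by
      intro k hk
      rw [← inv_smul_eq_iff, ← mul_smul, ← mul_smul, heis_inv, heis_mul, heis_mul] at hk
      convert hk using 2
      rw [heis_inj]
      refine ⟨by ring, by ring, by ring⟩
    have hci := conj i hi'
    have hcj := conj j hj'
    by_cases hab : a = 0 ∧ b = 0
    · obtain ⟨rfl, rfl⟩ := hab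
      refine ⟨c, ?_, ?_, by simpa using hci⟩
      · rintro rfl
        rw [heis_zero] at habc
        exact h1 (habc ▸ hpP i)
      · exact hc.trans_le (le_add_of_nonneg_right (by positivity))
    -- For `a ≠ 0`, the equality `b = L * a` would force `|b| ≥ L`.
    · have hne : b - L * a ≠ 0 := by
        intro h0
        by_cases ha0 : a = 0
        · subst ha0
          exact hab ⟨rfl, by simpa using h0⟩
        · have : |b| = L * |a| := by
            rw [show b = L * a by omega, abs_mul, abs_of_pos hL0]
          have : 1 ≤ |a| := Int.one_le_abs ha0
          nlinarith
      have hlt : |b - L * a| ≤ L + L * L := by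
        have h3 := abs_sub b (L * a)
        rw [abs_mul, abs_of_pos hL0] at h3
        nlinarith
      refine ⟨((i : ℤ) - j) * (b - L * a), ?_, ?_, ?_⟩
      · refine mul_ne_zero ?_ hne
        rw [sub_ne_zero]
        exact_mod_cast hij
      · have h4 : |(i : ℤ) - j| ≤ P.ncard := by
          simp only [Finset.mem_range] at hi hj
          rw [abs_le]
          constructor <;> omega
        rw [abs_mul]
        have := mul_le_mul h4 hlt (abs_nonneg _) (by positivity)
        exact this.trans_lt (lt_add_of_pos_left _ hL0)
      · have h5 : (heis a b (c - i * (b - L * a)))⁻¹ • heis a b (c - j * (b - L * a)) • x = x := by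
          rw [hcj, inv_smul_eq_iff, hci]
        rw [← mul_smul, heis_inv, heis_mul] at h5
        convert h5 using 2
        rw [heis_inj]
        refine ⟨by ring, by ring, by ring⟩
  set K : ℤ := L + P.ncard * (L + L * L) with hK
  -- The exponent `c` depends on `x`, but `|c| < K` makes `K!` a common multiple of all of them.
  have hfix : ∀ x : X, heis 0 0 (K.toNat.factorial : ℤ) • x = x := by
    intro x
    obtain ⟨c, hc0, hcK, hcx⟩ := key x
    have hmem : heis 0 0 c ∈ MulAction.stabilizer heisenbergGroup x := hcx
    have habs : heis 0 0 (c.natAbs : ℤ) ∈ MulAction.stabilizer heisenbergGroup x := by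
      rcases Int.natAbs_eq c with h | h
      · rwa [← h]
      · have h6 := inv_mem hmem
        rw [heis_inv] at h6
        convert h6 using 1
        rw [heis_inj]
        omega
    obtain ⟨d, hd⟩ : c.natAbs ∣ K.toNat.factorial :=
      Nat.dvd_factorial (Int.natAbs_pos.2 hc0) (by
        rw [Int.abs_eq_natAbs] at hcK
        omega)
    have h7 := pow_mem habs d
    rw [heis_pow_z] at h7
    rw [hd]
    have h8 : ((c.natAbs * d : ℕ) : ℤ) = d * (c.natAbs : ℤ) := by push_cast; ring
    rw [h8]
    exact h7
  have h9 : heis 0 0 (K.toNat.factorial : ℤ) = 1 :=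
    FaithfulSMul.eq_of_smul_eq_smul (α := X) fun x => by rw [hfix, one_smul]
  rw [← heis_zero, heis_inj] at h9
  exact K.toNat.factorial_ne_zero (by exact_mod_cast h9.2.2)

/-- Subgroups isomorphic to the Heisenberg group are non-folded in every faithful action. -/
theorem isNonFoldedIn_of_mulEquiv_heisenbergGroup {G : Type*} [Group G] {H : Subgroup G}
    (e : H ≃* heisenbergGroup) (X : Type*) [MulAction G X] [FaithfulSMul G X] :
    IsNonFoldedIn (H : Set G) X := by
  intro F hF hFH
  let ι : heisenbergGroup →* G := H.subtype.comp e.symm.toMonoidHom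
  have hι : Function.Injective ι := H.subtype_injective.comp e.symm.injective
  let _ : MulAction heisenbergGroup X := MulAction.compHom X ι
  have : FaithfulSMul heisenbergGroup X :=
    ⟨fun {a b} h => hι (FaithfulSMul.eq_of_smul_eq_smul (α := X) h)⟩
  -- `P` consists of the nontrivial quotients of elements of `F`, pulled back to the Heisenberg
  -- group.
  obtain ⟨x, hx⟩ := exists_forall_smul_ne_of_heisenbergGroup (X := X)
    (P := ι ⁻¹' ((fun q : G × G => q.1⁻¹ * q.2) '' (F ×ˢ F)) \ {1})
    ((((hF.prod hF).image _).preimage hι.injOn).sdiff) (by simp)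
  refine ⟨x, fun g hg h hh hgh => ?_⟩
  by_contra hne
  have hmem : g⁻¹ * h ∈ H := H.mul_mem (H.inv_mem (hFH hg)) (hFH hh)
  have hι' : ι (e ⟨g⁻¹ * h, hmem⟩) = g⁻¹ * h := by simp [ι]
  refine hx (e ⟨g⁻¹ * h, hmem⟩) ⟨⟨(g, h), ⟨hg, hh⟩, hι'.symm⟩, fun h1 => ?_⟩ ?_
  · rw [Set.mem_singleton_iff.1 h1, map_one] at hι'
    exact hne (inv_mul_eq_one.1 hι'.symm)
  · change ι (e ⟨g⁻¹ * h, hmem⟩) • x = x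
    rw [hι', mul_smul, inv_smul_eq_iff]
    exact hgh.symm

/-- Generators `x^{±1}, y^{±1}` of the Heisenberg group, with the identity. -/
def heisGen : Set heisenbergGroup := {1, heis 1 0 0, heis (-1) 0 0, heis 0 1 0, heis 0 (-1) 0}

/-- The corner is quadratically distorted: with `c = q * n + r`, the central factor is `⁅x ^ q, y ^
n⁆ * ⁅x ^ r, y⁆`, where `q, r ≤ n`. Together with `y ^ b * x ^ a` this makes ten factors of length
at most `n`, so a box of `n * n * n ^ 2` elements lies in a ball of radius `10 * n`. -/
theorem heis_mem_heisGen_pow {n a b c : ℕ} (ha : a < n) (hb : b < n) (hc : c < n ^ 2) :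
    heis a b c ∈ heisGen ^ (10 * n) := by
  have h1 : (1 : heisenbergGroup) ∈ heisGen := by simp [heisGen]
  have x1 : ∀ q ≤ n, heis q 0 0 ∈ heisGen ^ n := fun q hq => by
    refine Set.pow_subset_pow_right h1 hq ?_
    have := Set.pow_mem_pow (show heis 1 0 0 ∈ heisGen by simp [heisGen]) (n := q)
    rwa [heis_pow_x, mul_one] at this
  have x2 : ∀ q ≤ n, heis (-q) 0 0 ∈ heisGen ^ n := fun q hq => by
    refine Set.pow_subset_pow_right h1 hq ?_
    have := Set.pow_mem_pow (show heis (-1) 0 0 ∈ heisGen by simp [heisGen]) (n := q)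
    rwa [heis_pow_x, mul_neg_one] at this
  have y1 : ∀ q ≤ n, heis 0 q 0 ∈ heisGen ^ n := fun q hq => by
    refine Set.pow_subset_pow_right h1 hq ?_
    have := Set.pow_mem_pow (show heis 0 1 0 ∈ heisGen by simp [heisGen]) (n := q)
    rwa [heis_pow_y, mul_one] at this
  have y2 : ∀ q ≤ n, heis 0 (-q) 0 ∈ heisGen ^ n := fun q hq => by
    refine Set.pow_subset_pow_right h1 hq ?_
    have := Set.pow_mem_pow (show heis 0 (-1) 0 ∈ heisGen by simp [heisGen]) (n := q)
    rwa [heis_pow_y, mul_neg_one] at this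
  have hn : 0 < n := by omega
  have hq : c / n ≤ n := by
    rw [pow_two] at hc
    exact (Nat.div_lt_of_lt_mul hc).le
  have hr : c % n ≤ n := (Nat.mod_lt _ hn).le
  have hdiv : (c : ℤ) = (c / n : ℕ) * n + (c % n : ℕ) := by
    exact_mod_cast (Nat.div_add_mod' c n).symm
  have hprod : heis a b c = heis 0 b 0 * heis a 0 0 *
      heis (c / n : ℕ) 0 0 * heis 0 n 0 * heis (-(c / n : ℕ)) 0 0 * heis 0 (-n) 0 *
      heis (c % n : ℕ) 0 0 * heis 0 (1 : ℕ) 0 * heis (-(c % n : ℕ)) 0 0 * heis 0 (-(1 : ℕ)) 0 := by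
    simp only [heis_mul]
    rw [heis_inj]
    refine ⟨by ring, by ring, ?_⟩
    rw [hdiv]
    push_cast
    ring
  rw [hprod, show 10 * n = n + n + n + n + n + n + n + n + n + n by ring]
  simp only [pow_add]
  exact Set.mul_mem_mul (Set.mul_mem_mul (Set.mul_mem_mul (Set.mul_mem_mul (Set.mul_mem_mul
    (Set.mul_mem_mul (Set.mul_mem_mul (Set.mul_mem_mul (Set.mul_mem_mul (y1 _ hb.le) (x1 _ ha.le))
    (x1 _ hq)) (y1 _ le_rfl)) (x2 _ hq)) (y2 _ le_rfl)) (x1 _ hr)) (y1 _ hn)) (x2 _ hr)) (y2 _ hn)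

/-- Actions of groups containing the Heisenberg group have at least quartic growth when they are
faithful. -/
theorem growthLE_of_mulEquiv_heisenbergGroup {G : Type*} [Group G] {H : Subgroup G}
    (e : H ≃* heisenbergGroup) {X : Type*} [Nonempty X] [MulAction G X] [FaithfulSMul G X]
    {S : Set G} (hSf : S.Finite) (hS : Subgroup.closure S = ⊤) :
    GrowthLE (fun n => (n : ℝ) ^ 4) fun n => (actionGrowth S X n : ℝ) := by
  let ι : heisenbergGroup →* G := H.subtype.comp e.symm.toMonoidHom
  have hι : Function.Injective ι := H.subtype_injective.comp e.symm.injective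
  have hgf : heisGen.Finite := by simp [heisGen]
  obtain ⟨r, hr0, hr⟩ := exists_le_actionGrowth (X := X) hSf hS
    (B := ι '' (heisGen ^ 10)) (f := fun n => n ^ 4) ((Set.Finite.group_pow hgf _).image _) (by
      intro n
      let E : Set heisenbergGroup := (fun q : ℕ × ℕ × ℕ => heis q.1 q.2.1 q.2.2) ''
        ((Finset.range n ×ˢ Finset.range n ×ˢ Finset.range (n ^ 2) : Finset _) : Set (ℕ × ℕ × ℕ))
      have hE : E ⊆ (heisGen ^ 10) ^ n := by
        rintro _ ⟨⟨a, b, c⟩, h, rfl⟩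
        simp only [Finset.coe_product, Finset.coe_range, Set.mem_prod, Set.mem_Iio] at h
        rw [← pow_mul]
        exact heis_mem_heisGen_pow h.1 h.2.1 h.2.2
      have hEc : E.ncard = n ^ 4 := by
        rw [Set.ncard_image_of_injective, Set.ncard_coe_finset]
        · simp only [Finset.card_product, Finset.card_range]; ring
        · rintro ⟨a, b, c⟩ ⟨a', b', c'⟩ h
          simp only [heis_inj, Nat.cast_inj] at h
          simp only [Prod.mk.injEq]
          exact h
      have hEf : E.Finite := (Finset.finite_toSet _).image _
      obtain ⟨x, hx⟩ := isNonFoldedIn_of_mulEquiv_heisenbergGroup e X (ι '' E) (hEf.image _) (by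
        rintro _ ⟨h, _, rfl⟩
        simp [ι])
      refine ⟨x, ?_⟩
      rw [← hEc, ← Set.ncard_image_of_injective E hι, ← hx.ncard_image]
      refine Set.ncard_le_ncard (Set.image_mono ?_) ((Set.Finite.group_pow
        ((Set.Finite.group_pow hgf _).image _) _).image _)
      rw [← Set.image_pow]
      exact Set.image_mono hE)
  refine ⟨r, hr0, Filter.Eventually.of_forall fun n => ?_⟩
  have h1 : ((n ^ 4 : ℕ) : ℝ) ≤ (actionGrowth S X (r * n) : ℝ) := by exact_mod_cast hr n
  have h2 : (1 : ℝ) ≤ r := by exact_mod_cast hr0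
  push_cast at h1
  dsimp only
  exact h1.trans (le_mul_of_one_le_left (Nat.cast_nonneg _) h2)

/-! ### Heisenberg groups generated by two elements with central commutator -/

theorem mul_zpow_of_commutator {G : Type*} [Group G] {x y z : G}
    (hxy : x * y = z * y * x) (hyz : Commute y z) (b : ℤ) :
    x * y ^ b = z ^ b * y ^ b * x := by
  have h1 : x * y * x⁻¹ = z * y := by rw [hxy]; group
  have h2 := conj_zpow (i := b) (a := x) (b := y)
  rw [h1, (hyz.symm).mul_zpow] at h2
  rw [h2]; group

/-- Conjugating `x` by `y ^ (-b)` multiplies it by `z ^ b`; now take `a`-th powers, since `z`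
commutes with `x`. -/
theorem zpow_mul_zpow_of_commutator {G : Type*} [Group G] {x y z : G}
    (hxy : x * y = z * y * x) (hxz : Commute x z) (hyz : Commute y z) (a b : ℤ) :
    x ^ a * y ^ b = z ^ (a * b) * y ^ b * x ^ a := by
  have h1 : (y ^ b)⁻¹ * x * y ^ b = z ^ b * x := by
    rw [mul_assoc, mul_zpow_of_commutator hxy hyz b, (hyz.zpow_zpow b b).symm.eq]; group
  have h2 := conj_zpow (i := a) (a := (y ^ b)⁻¹) (b := x)
  rw [inv_inv, h1, (hxz.symm.zpow_left b).mul_zpow, ← zpow_mul] at h2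
  have h3 : x ^ a * y ^ b = y ^ b * (z ^ (b * a) * x ^ a) := by rw [h2]; group
  rw [h3, ← mul_assoc, (hyz.zpow_zpow b (b * a)).eq, mul_comm b a]

/-- Two elements whose commutator is central in the subgroup they generate and has infinite order
generate a Heisenberg group. -/
theorem exists_mulEquiv_heisenbergGroup {G : Type*} [Group G] {x y z : G}
    (hxy : x * y = z * y * x) (hxz : Commute x z) (hyz : Commute y z)
    (hz : ∀ n : ℤ, z ^ n = 1 → n = 0) :
    ∃ H : Subgroup G, Nonempty (H ≃* heisenbergGroup) := by
  have hconj := mul_zpow_of_commutator hxy hyz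
  have hcomm := zpow_mul_zpow_of_commutator hxy hxz hyz
  -- The order of the factors reflects `heis a b c = heis 0 b 0 * heis a 0 0 * heis 0 0 c`.
  let f : heisenbergGroup →* G :=
    { toFun := fun A => y ^ (A.1.1 1 2) * x ^ (A.1.1 0 1) * z ^ (A.1.1 0 2)
      map_one' := by simp
      map_mul' := by
        intro A B
        obtain ⟨a, b, c, rfl⟩ := exists_eq_heis A
        obtain ⟨a', b', c', rfl⟩ := exists_eq_heis B
        rw [heis_mul]
        have e1 : y ^ b * x ^ a * z ^ c * (y ^ b' * x ^ a' * z ^ c') =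
            y ^ b * (x ^ a * y ^ b') * x ^ a' * z ^ (c + c') := by
          have h4 : Commute (z ^ c) (y ^ b' * x ^ a') :=
            ((hyz.zpow_zpow b' c).mul_left (hxz.zpow_zpow a' c)).symm
          calc _ = y ^ b * x ^ a * (z ^ c * (y ^ b' * x ^ a')) * z ^ c' := by group
            _ = _ := by rw [h4.eq]; group
        have h5 : Commute (z ^ (a * b')) (y ^ b' * x ^ a * x ^ a') :=
          (((hyz.zpow_zpow _ _).mul_left (hxz.zpow_zpow _ _)).mul_left (hxz.zpow_zpow _ _)).symm
        have e2 : y ^ b * (x ^ a * y ^ b') * x ^ a' * z ^ (c + c') =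
            y ^ (b + b') * x ^ (a + a') * z ^ (c + c' + a * b') := by
          rw [hcomm a b']
          calc _ = y ^ b * (z ^ (a * b') * (y ^ b' * x ^ a * x ^ a')) * z ^ (c + c') := by group
            _ = _ := by rw [h5.eq]; simp only [zpow_add]; group
        simpa [heis] using (e1.trans e2).symm }
  have hf : Function.Injective f := by
    rw [injective_iff_map_eq_one]
    intro A hA
    obtain ⟨a, b, c, rfl⟩ := exists_eq_heis A
    have hA' : y ^ b * x ^ a * z ^ c = 1 := by simpa [f, heis] using hA
    -- Conjugation by `x` multiplies the image of `heis a b c` by `z ^ b`, but fixes `1`.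
    have hb : b = 0 := by
      apply hz
      have h6 : x * (y ^ b * x ^ a * z ^ c) * x⁻¹ = z ^ b * (y ^ b * x ^ a * z ^ c) := by
        have h7 : Commute x (x ^ a * z ^ c) :=
          ((Commute.refl x).zpow_right a).mul_right (hxz.zpow_right c)
        calc _ = (x * y ^ b) * (x ^ a * z ^ c) * x⁻¹ := by group
          _ = z ^ b * y ^ b * (x * (x ^ a * z ^ c)) * x⁻¹ := by rw [hconj]; group
          _ = _ := by rw [h7.eq]; group
      rw [hA'] at h6
      simpa using h6.symm
    subst hb
    -- Now `x ^ a = z ^ (-c)` commutes with `y`, whereas its commutator with `y` is `z ^ a`.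
    have ha : a = 0 := by
      apply hz
      have h8 := hcomm a 1
      simp only [zpow_zero, one_mul] at hA'
      have h9 : x ^ a = z ^ (-c) := by rw [zpow_neg]; exact eq_inv_of_mul_eq_one_left hA'
      have h10 : Commute (x ^ a) y := by rw [h9]; exact (hyz.zpow_right _).symm
      rw [zpow_one, h10.eq, mul_one, mul_assoc] at h8
      simpa using h8.symm
    subst ha
    have hc : c = 0 := hz c (by simpa using hA')
    rw [hc, heis_zero]
  exact ⟨f.range, ⟨(MonoidHom.ofInjective hf).symm⟩⟩

open scoped commutatorElement

/-! ## Finitely generated nilpotent groups -/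

open Subgroup IsMulCommutative in
/-- A finitely generated nilpotent torsion group is finite. -/
theorem finite_of_fg_of_isNilpotent_of_torsion (G : Type*) [Group G] [Group.IsNilpotent G] :
    Group.FG G → (∀ x : G, ∃ n : ℕ, 0 < n ∧ x ^ n = 1) → Finite G := by
  refine Group.nilpotent_center_quotient_ind (P := fun G _ _ => Group.FG G →
    (∀ x : G, ∃ n : ℕ, 0 < n ∧ x ^ n = 1) → Finite G) G (fun G _ _ _ _ => inferInstance) ?_
  intro G _ _ ih hfg ht
  have h1 : Finite (G ⧸ center G) := by
    refine ih inferInstance fun q => ?_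
    obtain ⟨x, rfl⟩ := QuotientGroup.mk'_surjective (center G) q
    obtain ⟨n, hn, hx⟩ := ht x
    exact ⟨n, hn, by rw [← map_pow, hx, map_one]⟩
  have h2 : (center G).FiniteIndex := finiteIndex_of_finite_quotient
  have h3 : Group.FG (center G) := fg_of_index_ne_zero (center G)
  have h4 : Finite (center G) := by
    refine CommGroup.finite_of_fg_isMulTorsion _ fun x => ?_
    obtain ⟨n, hn, hx⟩ := ht x
    exact isOfFinOrder_iff_pow_eq_one.2 ⟨n, hn, Subtype.ext hx⟩
  exact (finite_iff_finite_and_finiteIndex (H := center G)).2 ⟨h4, h2⟩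

open Subgroup in
/-- In a finitely generated nilpotent group, a subgroup containing a power of each element has
finite index. -/
theorem finiteIndex_of_forall_exists_pow_mem (G : Type*) [Group G] [Group.IsNilpotent G] :
    Group.FG G → ∀ D : Subgroup G, (∀ x : G, ∃ n : ℕ, 0 < n ∧ x ^ n ∈ D) → D.FiniteIndex := by
  refine Group.nilpotent_center_quotient_ind (P := fun G _ _ => Group.FG G → ∀ D : Subgroup G,
    (∀ x : G, ∃ n : ℕ, 0 < n ∧ x ^ n ∈ D) → D.FiniteIndex) G
    (fun G _ _ _ _ _ => ⟨Subgroup.index_ne_zero_of_finite⟩) ?_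
  intro G _ _ ih hfg D hD
  have h1 : (D.map (QuotientGroup.mk' (center G))).FiniteIndex := by
    refine ih inferInstance _ fun q => ?_
    obtain ⟨x, rfl⟩ := QuotientGroup.mk'_surjective (center G) q
    obtain ⟨n, hn, hx⟩ := hD x
    exact ⟨n, hn, by rw [← map_pow]; exact mem_map_of_mem _ hx⟩
  have h2 : (D ⊔ center G).FiniteIndex := by
    have h3 := index_comap_of_surjective (D.map (QuotientGroup.mk' (center G)))
      (QuotientGroup.mk'_surjective (center G))
    rw [comap_map_eq, QuotientGroup.ker_mk'] at h3
    exact ⟨by rw [h3]; exact h1.index_ne_zero⟩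
  -- Central factors do not affect conjugation, so `D` is normal in `D ⊔ center G`. The quotient is
  -- a finitely generated nilpotent torsion group, hence finite.
  have hn : (D.subgroupOf (D ⊔ center G)).Normal := by
    rw [normal_subgroupOf_iff le_sup_left]
    intro h k hh hk
    obtain ⟨d, hd, z, hz, rfl⟩ := mem_sup_of_normal_right.1 hk
    have h5 : d * z * h * (d * z)⁻¹ = d * h * d⁻¹ := by
      have h6 := mem_center_iff.1 hz h
      rw [mul_assoc d z h, ← h6]; group
    rw [h5]
    exact D.mul_mem (D.mul_mem hd hh) (D.inv_mem hd)
  have h7 : Group.FG ↥(D ⊔ center G) := fg_of_index_ne_zero _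
  have h8 : Finite (↥(D ⊔ center G) ⧸ D.subgroupOf (D ⊔ center G)) := by
    refine finite_of_fg_of_isNilpotent_of_torsion _ inferInstance fun q => ?_
    obtain ⟨x, rfl⟩ := QuotientGroup.mk'_surjective _ q
    obtain ⟨n, hn, hx⟩ := hD x
    refine ⟨n, hn, ?_⟩
    rw [← map_pow, QuotientGroup.mk'_apply, QuotientGroup.eq_one_iff, mem_subgroupOf]
    exact hx
  have h9 : D.relIndex (D ⊔ center G) ≠ 0 := index_ne_zero_iff_finite.2 h8
  refine ⟨?_⟩
  rw [← relIndex_mul_index (le_sup_left : D ≤ D ⊔ center G)]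
  exact mul_ne_zero h9 h2.index_ne_zero

/-! ### Bilinearity of central commutators and powers lying in a subgroup -/

theorem commutatorElement_pow_pow {G : Type*} [Group G] {x y : G}
    (hxy : ⁅x, y⁆ ∈ Subgroup.center G) (a b : ℕ) : ⁅x ^ a, y ^ b⁆ = ⁅x, y⁆ ^ (a * b) := by
  have h0 : x * y = ⁅x, y⁆ * y * x := by rw [commutatorElement_def]; group
  have h1 := zpow_mul_zpow_of_commutator h0 (Subgroup.mem_center_iff.1 hxy x)
    (Subgroup.mem_center_iff.1 hxy y) a b
  have h2 : x ^ a * y ^ b = ⁅x, y⁆ ^ (a * b) * y ^ b * x ^ a := by exact_mod_cast h1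
  rw [commutatorElement_def, h2]; group

theorem commutatorElement_mul_center {G : Type*} [Group G] {d e c c' : G}
    (hc : c ∈ Subgroup.center G) (hc' : c' ∈ Subgroup.center G) :
    ⁅d * c, e * c'⁆ = ⁅d, e⁆ := by
  have h1 : Commute c' (d * c) := (Subgroup.mem_center_iff.1 hc' (d * c)).symm
  have h2 : Commute c e := (Subgroup.mem_center_iff.1 hc e).symm
  calc ⁅d * c, e * c'⁆ = d * (c * e) * (c' * (d * c)⁻¹) * c'⁻¹ * e⁻¹ := by
        rw [commutatorElement_def]; group
    _ = ⁅d, e⁆ := by rw [h1.inv_right.eq, h2.eq, commutatorElement_def]; group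

open Subgroup in
-- If `a ^ m` and `b ^ n` agree with `d, e ∈ D` up to central factors, bilinearity gives `⁅a, b⁆ ^
-- (m * n) = ⁅d, e⁆ ∈ D`. Such commutators generate a central subgroup, so each of its elements has
-- a power in `D`, and the central error in `x ^ m` disappears after taking a further power.
theorem exists_pow_mem_of_sup_commutator_of_le_center {Q : Type*} [Group Q] {A D : Subgroup Q}
    (hA : ⁅A, (⊤ : Subgroup Q)⁆ ≤ center Q)
    (h : ∀ x : Q, ∃ m : ℕ, 0 < m ∧ x ^ m ∈ D ⊔ ⁅A, (⊤ : Subgroup Q)⁆) (x : Q) :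
    ∃ m : ℕ, 0 < m ∧ x ^ m ∈ D := by
  have hn : (⁅A, (⊤ : Subgroup Q)⁆).Normal := ⟨fun c hc g => by
    rw [mem_center_iff.1 (hA hc) g, mul_inv_cancel_right]; exact hc⟩
  have key : ∀ c ∈ ⁅A, (⊤ : Subgroup Q)⁆, ∃ m : ℕ, 0 < m ∧ c ^ m ∈ D := by
    intro c hc
    rw [Subgroup.commutator_def] at hc
    induction hc using closure_induction with
    | mem c hc =>
      obtain ⟨a, ha, b, hb, rfl⟩ := hc
      have hab := hA (commutator_mem_commutator ha hb)
      obtain ⟨m, hm, ham⟩ := h a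
      obtain ⟨n, hn, hbn⟩ := h b
      obtain ⟨d, hd, z, hz, hdz⟩ := mem_sup_of_normal_right.1 ham
      obtain ⟨e, he, z', hz', hez⟩ := mem_sup_of_normal_right.1 hbn
      refine ⟨m * n, mul_pos hm hn, ?_⟩
      rw [← commutatorElement_pow_pow hab, ← hdz, ← hez,
        commutatorElement_mul_center (hA hz) (hA hz')]
      exact D.mul_mem (D.mul_mem (D.mul_mem hd he) (D.inv_mem hd)) (D.inv_mem he)
    | one => exact ⟨1, one_pos, by simp⟩
    | mul c d hc hd h1 h2 =>
      obtain ⟨m, hm, hcm⟩ := h1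
      obtain ⟨n, hn, hdn⟩ := h2
      rw [← Subgroup.commutator_def] at hc
      have hcd : Commute c d := (mem_center_iff.1 (hA hc) d).symm
      refine ⟨m * n, mul_pos hm hn, ?_⟩
      rw [hcd.mul_pow, pow_mul c, mul_comm m n, pow_mul d]
      exact D.mul_mem (D.pow_mem hcm _) (D.pow_mem hdn _)
    | inv c _ h1 =>
      obtain ⟨m, hm, hcm⟩ := h1
      exact ⟨m, hm, by rw [inv_pow]; exact D.inv_mem hcm⟩
  obtain ⟨m, hm, hx⟩ := h x
  obtain ⟨d, hd, c, hc, hdc⟩ := mem_sup_of_normal_right.1 hx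
  obtain ⟨n, hn, hcn⟩ := key c hc
  refine ⟨m * n, mul_pos hm hn, ?_⟩
  have hcd : Commute d c := mem_center_iff.1 (hA hc) d
  rw [pow_mul, ← hdc, hcd.mul_pow]
  exact D.mul_mem (D.pow_mem hd _) hcn

open Subgroup in
/-- In a nilpotent group, a subgroup that contains a power of each element modulo the commutator
subgroup contains a power of each element. -/
theorem exists_pow_mem_of_sup_commutator {G : Type*} [Group G] [Group.IsNilpotent G]
    {D : Subgroup G} (h : ∀ x : G, ∃ m : ℕ, 0 < m ∧ x ^ m ∈ D ⊔ _root_.commutator G) (x : G) :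
    ∃ m : ℕ, 0 < m ∧ x ^ m ∈ D := by
  -- The error term is pushed down the lower central series. Modulo `L (i + 2)` the subgroup `L (i +
  -- 1) = ⁅L i, ⊤⁆` is central, so the preceding lemma applies with `A` the image of `L i`.
  have key : ∀ i : ℕ, ∀ x : G, ∃ m : ℕ, 0 < m ∧
      x ^ m ∈ D ⊔ (⊤ : Subgroup G).lowerCentralSeries (i + 1) := by
    intro i
    induction i with
    | zero => exact h
    | succ i ih =>
      set L := (⊤ : Subgroup G).lowerCentralSeries
      let π := QuotientGroup.mk' (L (i + 2))
      have hπ : Function.Surjective π := QuotientGroup.mk'_surjective _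
      have h1 : ⁅(L i).map π, (⊤ : Subgroup (G ⧸ L (i + 2)))⁆ = (L (i + 1)).map π := by
        rw [← map_top_of_surjective π hπ, ← map_commutator]; rfl
      have h2 : ⁅(L i).map π, (⊤ : Subgroup (G ⧸ L (i + 2)))⁆ ≤ center _ := by
        rw [h1]
        rintro _ ⟨c, hc, rfl⟩
        rw [mem_center_iff]
        intro q
        obtain ⟨g, rfl⟩ := hπ q
        rw [← map_mul, ← map_mul]
        refine QuotientGroup.eq.2 ?_
        have h3 : ⁅c⁻¹, g⁻¹⁆ ∈ L (i + 2) :=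
          commutator_mem_commutator ((L (i + 1)).inv_mem hc) (mem_top _)
        rw [commutatorElement_def, inv_inv, inv_inv] at h3
        simpa [mul_assoc] using h3
      intro x
      obtain ⟨m, hm, hx⟩ := exists_pow_mem_of_sup_commutator_of_le_center (D := D.map π) h2
        (fun q => by
          obtain ⟨g, rfl⟩ := hπ q
          obtain ⟨m, hm, hg⟩ := ih g
          refine ⟨m, hm, ?_⟩
          rw [h1, ← Subgroup.map_sup, ← map_pow]
          exact mem_map_of_mem _ hg) (π x)
      refine ⟨m, hm, ?_⟩
      rw [← map_pow, ← mem_comap, comap_map_eq, QuotientGroup.ker_mk'] at hx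
      exact hx
  obtain ⟨n, hn⟩ := Subgroup.nilpotent_iff_lowerCentralSeries.1 (inferInstance : Group.IsNilpotent G)
  obtain ⟨m, hm, hx⟩ := key n x
  refine ⟨m, hm, ?_⟩
  have h4 : (⊤ : Subgroup G).lowerCentralSeries (n + 1) = ⊥ := by
    rw [eq_bot_iff, ← hn]
    exact Subgroup.lowerCentralSeries_antitone _ n.le_succ
  rwa [h4, sup_bot_eq] at hx

/-! ## Heisenberg subgroups of nilpotent groups -/

open Subgroup in
-- Since `⁅s, y ^ M⁆ = ⁅s, y⁆ ^ M`, a common multiple `M` of the exponents for finitely many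
-- generators `s` makes `y ^ M` central.
theorem exists_pow_mem_center_of_commutator_torsion {Q : Type*} [Group Q] [Group.FG Q] {y : Q}
    (hy : ∀ x : Q, ⁅x, y⁆ ∈ center Q) (ht : ∀ x : Q, ∃ m : ℕ, 0 < m ∧ ⁅x, y⁆ ^ m = 1) :
    ∃ m : ℕ, 0 < m ∧ y ^ m ∈ center Q := by
  obtain ⟨S, hS, hSf⟩ := Group.fg_iff.1 (inferInstance : Group.FG Q)
  choose m hm0 hm using ht
  let M := ∏ s ∈ hSf.toFinset, m s
  refine ⟨M, Finset.prod_pos fun s _ => hm0 s, ?_⟩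
  have h1 : Subgroup.closure S ≤ Subgroup.centralizer {y ^ M} := by
    rw [closure_le]
    intro s hs
    rw [SetLike.mem_coe, mem_centralizer_singleton_iff]
    have h2 : m s ∣ M := Finset.dvd_prod_of_mem m (hSf.mem_toFinset.2 hs)
    obtain ⟨k, hk⟩ := h2
    have h3 := commutatorElement_pow_pow (hy s) 1 M
    have h4 : ⁅s, y⁆ ^ (1 * M) = 1 := by rw [one_mul, hk, pow_mul, hm, one_pow]
    rwa [h4, pow_one, commutatorElement_eq_one_iff_mul_comm] at h3
  rw [hS] at h1
  rw [mem_center_iff]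
  intro g
  exact (mem_centralizer_singleton_iff.1 (h1 (mem_top g)))

open Subgroup in
/-- A finitely generated nilpotent group is virtually central, as soon as all commutators of
elements `x` with elements `y` that are central modulo the center are torsion. -/
theorem finiteIndex_center_of_commutator_torsion {N : Type*} [Group N] [Group.FG N]
    [Group.IsNilpotent N]
    (h : ∀ x y : N, (∀ g : N, ⁅g, y⁆ ∈ center N) → ∃ m : ℕ, 0 < m ∧ ⁅x, y⁆ ^ m = 1) :
    (center N).FiniteIndex := by
  have swap : ∀ (i : ℕ) {x y : N}, ⁅x, y⁆ ∈ Subgroup.upperCentralSeries N i ↔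
      ⁅y, x⁆ ∈ Subgroup.upperCentralSeries N i := fun i x y => by
    rw [← commutatorElement_inv, inv_mem_iff]
  -- Torsion propagates up the upper central series: each factor above the center is torsion.
  have step : ∀ i : ℕ, ∀ y ∈ Subgroup.upperCentralSeries N (i + 2), ∃ m : ℕ, 0 < m ∧
      y ^ m ∈ Subgroup.upperCentralSeries N (i + 1) := by
    intro i
    induction i with
    | zero =>
      intro y hy
      have hy' : ∀ g : N, ⁅g, y⁆ ∈ center N := fun g => by
        rw [← Subgroup.upperCentralSeries_one, swap]
        exact Subgroup.mem_upperCentralSeries_succ_iff.1 hy g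
      simp only [zero_add, Subgroup.upperCentralSeries_one]
      exact exists_pow_mem_center_of_commutator_torsion hy' fun x => h x y hy'
    | succ i ih =>
      intro y hy
      -- Modulo this term the commutators `⁅g, y⁆` become central, and torsion by the induction
      -- hypothesis.
      let π := QuotientGroup.mk' (Subgroup.upperCentralSeries N (i + 1))
      have hπ : Function.Surjective π := QuotientGroup.mk'_surjective _
      have hc : ∀ z : N, π z ∈ center (N ⧸ Subgroup.upperCentralSeries N (i + 1)) ↔
          z ∈ Subgroup.upperCentralSeries N (i + 2) := by
        intro z
        rw [Subgroup.mem_upperCentralSeries_succ_iff, mem_center_iff, hπ.forall]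
        refine forall_congr' fun g => ?_
        rw [swap, ← QuotientGroup.eq_one_iff, ← QuotientGroup.mk'_apply, map_commutatorElement,
          commutatorElement_eq_one_iff_mul_comm]
      obtain ⟨m, hm, hym⟩ := exists_pow_mem_center_of_commutator_torsion (y := π y)
        (fun q => by
          obtain ⟨g, rfl⟩ := hπ q
          rw [← map_commutatorElement, hc, swap]
          exact Subgroup.mem_upperCentralSeries_succ_iff.1 hy g)
        (fun q => by
          obtain ⟨g, rfl⟩ := hπ q
          obtain ⟨m, hm, hx⟩ := ih ⁅g, y⁆ ((swap _).2 (Subgroup.mem_upperCentralSeries_succ_iff.1 hy g))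
          refine ⟨m, hm, ?_⟩
          rw [← map_commutatorElement, ← map_pow]
          exact (QuotientGroup.eq_one_iff _).2 hx)
      refine ⟨m, hm, ?_⟩
      rwa [← map_pow, hc] at hym
  refine finiteIndex_of_forall_exists_pow_mem N inferInstance _ fun x => ?_
  obtain ⟨n, hn⟩ := Group.IsNilpotent.nilpotent N
  have hall : ∀ i : ℕ, ∀ y ∈ Subgroup.upperCentralSeries N (i + 1), ∃ m : ℕ, 0 < m ∧ y ^ m ∈ center N := by
    intro i
    induction i with
    | zero => exact fun y hy => ⟨1, one_pos, by
        rw [pow_one, ← Subgroup.upperCentralSeries_one]; exact hy⟩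
    | succ i ih =>
      intro y hy
      obtain ⟨m, hm, hym⟩ := step i y hy
      obtain ⟨k, hk, hyk⟩ := ih _ hym
      exact ⟨m * k, mul_pos hm hk, by rwa [pow_mul]⟩
  exact hall n x (Subgroup.upperCentralSeries_mono N n.le_succ (hn ▸ mem_top x))

open Subgroup in
/-- A finitely generated, virtually nilpotent group that is not virtually abelian contains a
Heisenberg group. -/
theorem exists_heisenberg_of_not_isVirtuallyAbelian {G : Type*} [Group G] [Group.FG G]
    (hG : Group.IsVirtuallyNilpotent G) (hab : ¬ IsVirtuallyAbelian G) :
    ∃ H : Subgroup G, Nonempty (H ≃* heisenbergGroup) := by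
  obtain ⟨N, hN, hNi⟩ := hG
  have hfg : Group.FG N := fg_of_index_ne_zero N
  by_contra hcon
  apply hab
  have hc : (center N).FiniteIndex := by
    refine finiteIndex_center_of_commutator_torsion fun x y hy => ?_
    by_contra! ht
    apply hcon
    have hz := hy x
    set z := ⁅x, y⁆ with hzdef
    refine exists_mulEquiv_heisenbergGroup (x := (x : G)) (y := y) (z := z) ?_ ?_ ?_ ?_
    · rw [hzdef, commutatorElement_def]; push_cast; group
    · exact congrArg Subtype.val (mem_center_iff.1 hz x)
    · exact congrArg Subtype.val (mem_center_iff.1 hz y)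
    · intro n hn
      by_contra hn0
      refine ht n.natAbs (Int.natAbs_pos.2 hn0) ?_
      have h1 : z ^ n = 1 := Subtype.ext (by exact_mod_cast hn)
      rcases Int.natAbs_eq n with h | h
      · rw [h] at h1; exact_mod_cast h1
      · rw [h, zpow_neg, inv_eq_one] at h1; exact_mod_cast h1
  refine ⟨(center N).map N.subtype, ?_, ⟨?_⟩⟩
  · infer_instance
  · rw [index_map_subtype]
    exact mul_ne_zero hc.index_ne_zero hNi.index_ne_zero

/-! ## Polycyclic groups -/

/-- A subgroup whose cosets by finitely many elements cover `M` has finite index in `M`. -/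
theorem relIndex_ne_zero_of_finite_cover {G : Type*} [Group G] {M' M : Subgroup G} {F : Set G}
    (hF : F.Finite) (h : ∀ v ∈ M, ∃ f ∈ F, f⁻¹ * v ∈ M') : M'.relIndex M ≠ 0 := by
  have : Finite F := hF
  choose f hfF hf using h
  have : Finite (M ⧸ M'.subgroupOf M) := by
    refine Finite.of_injective (β := F) (fun q => ⟨f q.out.1 q.out.2, hfF _ _⟩) fun p q hpq => ?_
    have h1 : f p.out.1 p.out.2 = f q.out.1 q.out.2 := congrArg Subtype.val hpq
    rw [← QuotientGroup.out_eq' p, ← QuotientGroup.out_eq' q, QuotientGroup.eq,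
      Subgroup.mem_subgroupOf]
    have h2 := M'.mul_mem (M'.inv_mem (hf p.out.1 p.out.2)) (hf q.out.1 q.out.2)
    rw [h1] at h2
    simpa [mul_assoc] using h2
  exact Subgroup.index_ne_zero_of_finite

theorem exists_finite_cover_of_relIndex_ne_zero {G : Type*} [Group G] {M' M : Subgroup G}
    (h : M'.relIndex M ≠ 0) :
    ∃ F : Set G, F.Finite ∧ F ⊆ M ∧ ∀ v ∈ M, ∃ f ∈ F, f⁻¹ * v ∈ M' := by
  have : Finite (M ⧸ M'.subgroupOf M) := Subgroup.index_ne_zero_iff_finite.1 h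
  refine ⟨Set.range fun q : M ⧸ M'.subgroupOf M => (q.out : G), Set.finite_range _, ?_, ?_⟩
  · rintro _ ⟨q, rfl⟩
    exact q.out.2
  · intro v hv
    refine ⟨_, ⟨QuotientGroup.mk ⟨v, hv⟩, rfl⟩, ?_⟩
    have h1 := QuotientGroup.eq.1 (QuotientGroup.out_eq' (QuotientGroup.mk (s := M'.subgroupOf M)
      (⟨v, hv⟩ : M)))
    exact h1

/-- `K` is a normal subgroup of `L` with cyclic quotient. -/
def CyclicStep {G : Type*} [Group G] (K L : Subgroup G) : Prop :=
  K ≤ L ∧ (∀ k ∈ K, ∀ l ∈ L, l * k * l⁻¹ ∈ K) ∧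
    ∀ M ≤ L, ∃ m ∈ M, ∀ v ∈ M, ∃ n : ℤ, v * m ^ n ∈ K

/-- The image of `M` in the cyclic group `L / K` is cyclic; a lift of its generator serves as `m`.
-/
theorem IsPolycyclic.exists_cyclicStep {G : Type*} [Group G] (h : IsPolycyclic G) :
    ∃ (n : ℕ) (H : ℕ → Subgroup G), H 0 = ⊥ ∧ H n = ⊤ ∧
      ∀ i < n, CyclicStep (H i) (H (i + 1)) := by
  obtain ⟨n, H, h0, hn, h⟩ := h
  refine ⟨n, H, h0, hn, fun i hi => ?_⟩
  obtain ⟨hle, hnorm, hcyc⟩ := h i hi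
  set K := H i
  set L := H (i + 1)
  refine ⟨hle, fun k hk l hl => (Subgroup.normal_subgroupOf_iff hle).1 hnorm k l hk hl,
    fun M hM => ?_⟩
  let π := QuotientGroup.mk' (K.subgroupOf L)
  obtain ⟨⟨_, ⟨⟨m, hmL⟩, hmM, rfl⟩⟩, hg⟩ :=
    IsCyclic.exists_generator (α := ↥((M.subgroupOf L).map π))
  refine ⟨m, hmM, fun v hv => ?_⟩
  obtain ⟨n, hn⟩ := hg ⟨π ⟨v, hM hv⟩, ⟨_, hv, rfl⟩⟩
  have h1 : π ⟨m, hmL⟩ ^ n = π ⟨v, hM hv⟩ := congrArg Subtype.val hn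
  refine ⟨-n, ?_⟩
  have h2 : π (⟨v, hM hv⟩ * ⟨m, hmL⟩ ^ (-n)) = 1 := by
    rw [map_mul, map_zpow, zpow_neg, h1, mul_inv_cancel]
  have h3 := (QuotientGroup.eq_one_iff (N := K.subgroupOf L) _).1 h2
  rw [Subgroup.mem_subgroupOf] at h3
  exact h3

theorem CyclicStep.conj_mem {G : Type*} [Group G] {K L : Subgroup G} (h : CyclicStep K L)
    {k l : G} (hk : k ∈ K) (hl : l ∈ L) : l * k * l⁻¹ ∈ K := h.2.1 k hk l hl

/-- Subgroups of polycyclic groups are finitely generated. -/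
theorem IsPolycyclic.subgroup_fg {G : Type*} [Group G] (h : IsPolycyclic G) (M : Subgroup G) :
    M.FG := by
  obtain ⟨n, H, h0, hn, hs⟩ := h.exists_cyclicStep
  have key : ∀ i ≤ n, ∀ M ≤ H i, M.FG := by
    intro i
    induction i with
    | zero =>
      intro _ M hM
      rw [h0, le_bot_iff] at hM
      exact hM ▸ Subgroup.FG.bot
    | succ i ih =>
      intro hi M hM
      obtain ⟨m, hm, hv⟩ := (hs i hi).2.2 M hM
      have h1 : M = M ⊓ H i ⊔ Subgroup.closure {m} := by
        refine le_antisymm (fun v hvM => ?_) (sup_le inf_le_left ?_)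
        · obtain ⟨k, hk⟩ := hv v hvM
          have h2 : v = v * m ^ k * m ^ (-k) := by group
          have h4 : v * m ^ k ∈ M ⊓ H i :=
            Subgroup.mem_inf.2 ⟨M.mul_mem hvM (M.zpow_mem hm k), hk⟩
          have h5 : m ^ (-k) ∈ Subgroup.closure {m} :=
            Subgroup.zpow_mem _ (Subgroup.subset_closure (Set.mem_singleton m)) _
          rw [h2]
          exact Subgroup.mul_mem_sup h4 h5
        · simpa using hm
      have h3 : (M ⊓ H i ⊔ Subgroup.closure {m}).FG :=
        (ih (Nat.le_of_succ_le hi) _ inf_le_right).sup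
          ((Subgroup.fg_iff _).2 ⟨{m}, rfl, Set.finite_singleton m⟩)
      rwa [← h1] at h3
  exact key n le_rfl M (hn ▸ le_top)

/-- A Hirsch length on the subgroups of `G`: a monotone function that drops strictly when passing to
a subgroup of infinite index. -/
def IsHirschLength {G : Type*} [Group G] (h : Subgroup G → ℕ) : Prop :=
  ∀ M' M : Subgroup G, M' ≤ M → h M' ≤ h M ∧ (h M' = h M → M'.relIndex M ≠ 0)

open Classical in
-- The length counts the infinite factors that the series induces on `M`. When `M' ≤ M` have equal
-- length, both summands agree at each step: `M' ⊓ K` has finite index in `M ⊓ K`, and the images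
-- modulo `K` are both finite or both infinite cyclic. In the latter case one has finite index in
-- the other.
theorem IsPolycyclic.exists_isHirschLength {G : Type*} [Group G] (hG : IsPolycyclic G) :
    ∃ h : Subgroup G → ℕ, IsHirschLength h := by
  obtain ⟨n, H, h0, hn, hs⟩ := hG.exists_cyclicStep
  have key : ∀ i ≤ n, ∃ h : Subgroup G → ℕ, ∀ M' M : Subgroup G, M' ≤ M → M ≤ H i →
      h M' ≤ h M ∧ (h M' = h M → M'.relIndex M ≠ 0) := by
    intro i
    induction i with
    | zero =>
      refine fun _ => ⟨fun _ => 0, fun M' M _ hM => ⟨le_rfl, fun _ => ?_⟩⟩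
      rw [h0, le_bot_iff] at hM
      simp [hM]
    | succ i ih =>
      intro hi
      obtain ⟨h, hh⟩ := ih (Nat.le_of_succ_le hi)
      set K := H i
      refine ⟨fun M => h (M ⊓ K) + if K.relIndex M = 0 then 1 else 0, fun M' M hle hM => ?_⟩
      obtain ⟨h1, h2⟩ := hh (M' ⊓ K) (M ⊓ K) (inf_le_inf_right K hle) inf_le_right
      have h3 : K.relIndex M' = 0 → K.relIndex M = 0 :=
        Subgroup.relIndex_eq_zero_of_le_right hle
      have hle' : (if K.relIndex M' = 0 then 1 else 0) ≤ if K.relIndex M = 0 then 1 else 0 := by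
        split_ifs <;> simp_all
      refine ⟨add_le_add h1 hle', fun heq => ?_⟩
      have heq' : h (M' ⊓ K) + (if K.relIndex M' = 0 then 1 else 0) =
        h (M ⊓ K) + if K.relIndex M = 0 then 1 else 0 := heq
      have h4 : (M' ⊓ K).relIndex (M ⊓ K) ≠ 0 := h2 (by omega)
      have h5 : (if K.relIndex M' = 0 then 1 else 0) = if K.relIndex M = 0 then 1 else 0 := by
        omega
      have h6 : M'.relIndex (M ⊓ K) ≠ 0 := fun h7 =>
        h4 (Subgroup.relIndex_eq_zero_of_le_left inf_le_left h7)
      by_cases hK : K.relIndex M = 0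
      · have hK' : K.relIndex M' = 0 := by
          by_contra h7
          simp [hK, h7] at h5
        obtain ⟨m, hm, hmv⟩ := (hs i hi).2.2 M hM
        -- If a nonzero power of the generator `b` of `M'` modulo `K` lay in `K`, finitely many
        -- powers of `b` would represent all cosets, so `M'` would have finite image.
        obtain ⟨b, hb, hbv⟩ : ∃ b ∈ M', ∀ n : ℤ, n ≠ 0 → b ^ n ∉ K := by
          obtain ⟨b, hb, hbv⟩ := (hs i hi).2.2 M' (hle.trans hM)
          refine ⟨b, hb, fun n hn0 hbn => ?_⟩
          have hbn' : b ^ n.natAbs ∈ K := by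
            rcases Int.natAbs_eq n with h7 | h7
            · rw [h7] at hbn; exact_mod_cast hbn
            · rw [h7, zpow_neg, inv_mem_iff] at hbn; exact_mod_cast hbn
          refine relIndex_ne_zero_of_finite_cover (M' := K) (M := M')
            (F := (fun r : ℕ => b ^ r) '' Set.Iio n.natAbs)
            ((Set.finite_Iio _).image _) (fun v hv => ?_) hK'
          obtain ⟨k, hk⟩ := hbv v hv
          have hn1 : (n.natAbs : ℤ) ≠ 0 := by simpa using hn0
          have hr := Int.emod_nonneg (-k) hn1
          have hr' := Int.emod_lt_of_pos (-k) (show (0 : ℤ) < n.natAbs by omega)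
          refine ⟨_, ⟨((-k) % n.natAbs).toNat, by simp only [Set.mem_Iio]; omega, rfl⟩, ?_⟩
          have h8 : b ^ (((-k) % n.natAbs).toNat) = b ^ ((-k) % n.natAbs) := by
            rw [← zpow_natCast, Int.toNat_of_nonneg hr]
          have h9 : (b ^ ((-k) % (n.natAbs : ℤ)))⁻¹ = b ^ ((n.natAbs : ℤ) * (-k / n.natAbs)) * b ^ k := by
            rw [← zpow_neg, ← zpow_add]
            congr 1
            have := Int.mul_ediv_add_emod (-k) n.natAbs
            omega
          have h10 : b ^ k * v = v⁻¹ * (v * b ^ k) * v⁻¹⁻¹ := by group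
          simp only
          rw [h8, h9, zpow_mul, zpow_natCast, mul_assoc]
          refine K.mul_mem (K.zpow_mem hbn' _) ?_
          rw [h10]
          exact (hs i hi).conj_mem hk (hM (hle (M'.inv_mem hv)))
        obtain ⟨F, hFf, hFM, hF⟩ := exists_finite_cover_of_relIndex_ne_zero h6
        obtain ⟨a, ha⟩ := hmv b (hle hb)
        have ha0 : a ≠ 0 := by
          rintro rfl
          exact hbv 1 one_ne_zero (by simpa using ha)
        have hbL := hM (hle hb)
        have hmL := hM hm
        -- modulo `K`, `b = m ^ (-a)`
        have hpow : ∀ q : ℤ, b ^ q * m ^ (a * q) ∈ K := by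
          have hnat : ∀ q : ℕ, b ^ q * (m ^ a) ^ q ∈ K := by
            intro q
            induction q with
            | zero => simp
            | succ q ihq =>
              have h11 : b ^ (q + 1) * (m ^ a) ^ (q + 1) =
                  (b * (b ^ q * (m ^ a) ^ q) * b⁻¹) * (b * m ^ a) := by
                rw [pow_succ', pow_succ]; group
              rw [h11]
              exact K.mul_mem ((hs i hi).conj_mem ihq hbL) ha
          intro q
          obtain ⟨q, rfl | rfl⟩ := q.eq_nat_or_neg
          · rw [zpow_mul]; exact_mod_cast hnat q
          · have h12 : b ^ (-q : ℤ) * m ^ (a * (-q : ℤ)) =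
                b ^ (-q : ℤ) * ((b ^ q * (m ^ a) ^ q)⁻¹) * (b ^ (-q : ℤ))⁻¹ := by
              rw [zpow_mul]; simp only [zpow_neg, zpow_natCast]; group
            rw [h12]
            exact (hs i hi).conj_mem (K.inv_mem (hnat _)) ((H (i + 1)).zpow_mem hbL _)
        -- Modulo `K`, `v` is `m ^ (-k)`. Writing `-k = r + a * q` with `0 ≤ r < |a|`, the element
        -- `m ^ (-r) * v * b ^ q` lies in `M ⊓ K`, which `F` covers modulo `M'`.
        refine relIndex_ne_zero_of_finite_cover
          (F := Set.image2 (fun (r : ℕ) f => m ^ r * f) (Set.Iio a.natAbs) F)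
          ((Set.finite_Iio _).image2 _ hFf) fun v hv => ?_
        obtain ⟨k, hk⟩ := hmv v hv
        have hn1 : (a.natAbs : ℤ) ≠ 0 := by simpa using ha0
        have hr := Int.emod_nonneg (-k) hn1
        have hr' := Int.emod_lt_of_pos (-k) (show (0 : ℤ) < a.natAbs by omega)
        obtain ⟨q, hq⟩ : ∃ q : ℤ, -k = (-k) % a.natAbs + a * q := by
          obtain ⟨s, hs⟩ : a ∣ (a.natAbs : ℤ) := Int.dvd_natAbs.2 dvd_rfl
          refine ⟨s * (-k / a.natAbs), ?_⟩
          rw [← mul_assoc, ← hs]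
          have h13 := Int.mul_ediv_add_emod (-k) a.natAbs
          omega
        set r := (-k) % (a.natAbs : ℤ)
        have hmem : m ^ (-r) * v * b ^ q ∈ M ⊓ K := by
          refine ⟨M.mul_mem (M.mul_mem (M.zpow_mem hm _) hv) (M.zpow_mem (hle hb) _), ?_⟩
          have h14 : m ^ (-r) * v * b ^ q = (m ^ (-r) * (v * m ^ k) * (m ^ (-r))⁻¹) *
              (m ^ (a * q) * (b ^ q * m ^ (a * q)) * (m ^ (a * q))⁻¹) := by
            have h15 : k = -r - a * q := by omega
            rw [h15]
            simp only [zpow_sub, zpow_neg]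
            group
          rw [h14]
          exact K.mul_mem ((hs i hi).conj_mem hk ((H (i + 1)).zpow_mem hmL _))
            ((hs i hi).conj_mem (hpow q) ((H (i + 1)).zpow_mem hmL _))
        obtain ⟨f, hf, hfm⟩ := hF _ hmem
        refine ⟨_, ⟨r.toNat, by simp only [Set.mem_Iio]; omega, f, hf, rfl⟩, ?_⟩
        have h16 : (m ^ r.toNat * f)⁻¹ * v = f⁻¹ * (m ^ (-r) * v * b ^ q) * (b ^ q)⁻¹ := by
          rw [← zpow_natCast, Int.toNat_of_nonneg hr]; group
        rw [h16]
        exact M'.mul_mem hfm (M'.inv_mem (M'.zpow_mem hb _))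
      · refine Subgroup.relIndex_ne_zero_trans h6 ?_
        rw [Subgroup.inf_relIndex_left]
        exact hK
  obtain ⟨h, hh⟩ := key n le_rfl
  exact ⟨h, fun M' M hle => hh M' M hle (hn ▸ le_top)⟩

/-- A finitely generated group has finitely many subgroups of a given finite index. -/
theorem finite_setOf_index_eq (G : Type*) [Group G] [Group.FG G] {n : ℕ} (hn : n ≠ 0) :
    {K : Subgroup G | K.index = n}.Finite := by
  obtain ⟨S, hS, hSf⟩ := Group.fg_iff.1 (inferInstance : Group.FG G)
  have : Finite S := hSf
  have hfin : Finite (G →* Equiv.Perm (Fin n)) :=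
    Finite.of_injective (fun (f : G →* Equiv.Perm (Fin n)) (s : S) => f s) fun f g hfg =>
      MonoidHom.eq_of_eqOn_dense hS fun s hs => congrFun hfg ⟨s, hs⟩
  -- Each such subgroup is a point stabilizer of its action on cosets, and there are finitely many
  -- homomorphisms to a finite symmetric group.
  refine (Set.finite_range fun q : (G →* Equiv.Perm (Fin n)) × Fin n =>
    (MulAction.stabilizer (Equiv.Perm (Fin n)) q.2).comap q.1).subset fun K hK => ?_
  have : Finite (G ⧸ K) := Subgroup.index_ne_zero_iff_finite.1 (by rw [hK]; exact hn)
  let e : G ⧸ K ≃ Fin n := Finite.equivFinOfCardEq hK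
  refine ⟨(e.permCongrHom.toMonoidHom.comp (MulAction.toPermHom G (G ⧸ K)), e (QuotientGroup.mk 1)),
    ?_⟩
  ext g
  simp only [Subgroup.mem_comap, MulAction.mem_stabilizer_iff]
  simp [Equiv.permCongrHom, QuotientGroup.eq]

open Subgroup in
/-- A polycyclic group that is not virtually nilpotent contains a nilpotent subgroup `N` normalized
by an element `t`, none of whose positive powers generates a nilpotent group together with `N`. -/
theorem IsPolycyclic.exists_nilpotent_of_not_isVirtuallyNilpotent {G : Type*} [Group G]
    (hG : IsPolycyclic G) (hv : ¬ Group.IsVirtuallyNilpotent G) :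
    ∃ (N : Subgroup G) (t : G), Group.IsNilpotent N ∧ N.map (MulAut.conj t).toMonoidHom = N ∧
      ∀ k : ℕ, 0 < k → ¬ Group.IsNilpotent ↥(N ⊔ zpowers (t ^ k)) := by
  obtain ⟨n, H, h0, hn, hs⟩ := hG.exists_cyclicStep
  -- The first place in the series where virtual nilpotency is lost.
  obtain ⟨i, hi, hvi, hvs⟩ : ∃ i < n, Group.IsVirtuallyNilpotent (H i) ∧
      ¬ Group.IsVirtuallyNilpotent (H (i + 1)) := by
    by_contra! hcon
    have hall : ∀ i ≤ n, Group.IsVirtuallyNilpotent (H i) := by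
      intro i
      induction i with
      | zero =>
        intro _
        rw [h0]
        exact Group.IsNilpotent.isVirtuallyNilpotent inferInstance
      | succ i ih => exact fun h => hcon i h (ih (Nat.le_of_succ_le h))
    apply hv
    obtain ⟨N, hN, hNi⟩ := hn ▸ hall n le_rfl
    refine ⟨N.map (⊤ : Subgroup G).subtype, ?_, ⟨?_⟩⟩
    · exact (Group.isNilpotent_congr (N.equivMapOfInjective _ (subtype_injective _))).1 hN
    · rw [index_map_subtype]
      simpa using hNi.index_ne_zero
  have hstep := hs i hi
  set K := H i
  set L := H (i + 1)
  obtain ⟨N₀, hN₀, hN₀i⟩ := hvi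
  obtain ⟨t, htL, ht⟩ := hstep.2.2 L le_rfl
  let N := N₀.map K.subtype
  have hNK : N ≤ K := map_subtype_le N₀
  have hNi : N.relIndex K ≠ 0 := by
    have h1 : N.relIndex K = N₀.index := by
      rw [relIndex, subgroupOf, comap_map_eq_self_of_injective (subtype_injective K)]
    rw [h1]
    exact hN₀i.index_ne_zero
  have hNn : Group.IsNilpotent N :=
    (Group.isNilpotent_congr (N₀.equivMapOfInjective _ (subtype_injective _))).1 hN₀
  let c : ℕ → G →* G := fun j => (MulAut.conj (t ^ j)).toMonoidHom
  have hcinj : ∀ j, Function.Injective (c j) := fun j => (MulAut.conj (t ^ j)).injective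
  have hKc : ∀ j, K.map (c j) = K := by
    intro j
    ext x
    constructor
    · rintro ⟨y, hy, rfl⟩
      exact hstep.2.1 y hy _ (L.pow_mem htL j)
    · intro hx
      refine ⟨(t ^ j)⁻¹ * x * t ^ j, ?_, by
        change t ^ j * ((t ^ j)⁻¹ * x * t ^ j) * (t ^ j)⁻¹ = x
        group⟩
      have h2 := hstep.2.1 x hx _ (L.inv_mem (L.pow_mem htL j))
      rwa [inv_inv] at h2
  -- The conjugates of `N` by powers of `t` all have the same finite index in `K`, so two coincide
  -- and `t ^ (s - r)` normalizes `N`.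
  obtain ⟨r, s, hrs, hmap⟩ : ∃ r s : ℕ, r < s ∧ N.map (c r) = N.map (c s) := by
    have hfgK : Group.FG K := (Group.fg_iff_subgroup_fg K).2 (hG.subgroup_fg K)
    obtain ⟨r, s, hrs, h⟩ := (finite_setOf_index_eq K hNi).exists_lt_map_eq_of_forall_mem
      (f := fun j : ℕ => (N.map (c j)).subgroupOf K) (fun j => by
        change (N.map (c j)).relIndex K = N.relIndex K
        conv_lhs => rw [← hKc j]
        exact relIndex_map_map_of_injective N K (hcinj j))
    refine ⟨r, s, hrs, ?_⟩
    have hle : ∀ j, N.map (c j) ≤ K := fun j => (map_mono hNK).trans (hKc j).le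
    have h3 := congrArg (map K.subtype) h
    simp only [subgroupOf_map_subtype] at h3
    rwa [inf_eq_left.2 (hle r), inf_eq_left.2 (hle s)] at h3
  have hd : 0 < s - r := by omega
  refine ⟨N, t ^ (s - r), hNn, ?_, fun k hk hnil => hvs ?_⟩
  · apply map_injective (hcinj r)
    rw [map_map, hmap]
    congr 1
    ext x
    simp only [c, MonoidHom.comp_apply, MulEquiv.coe_toMonoidHom, MulAut.conj_apply]
    have h4 : t ^ s = t ^ r * t ^ (s - r) := by rw [← pow_add]; congr 1; omega
    rw [h4]; group
  · rw [← pow_mul] at hnil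
    set m := (s - r) * k with hm
    have hm0 : 0 < m := mul_pos hd hk
    set E := N ⊔ zpowers (t ^ m)
    have hEL : E ≤ L := sup_le (hNK.trans hstep.1) (by simpa using L.pow_mem htL m)
    refine ⟨E.subgroupOf L, (Group.isNilpotent_congr (subgroupOfEquivOfLe hEL)).2 hnil, ⟨?_⟩⟩
    change E.relIndex L ≠ 0
    -- `t` generates `L` modulo `K` and `N` has finite index in `K`, so `E` has finite index in `L`;
    -- its nilpotency would make `L` virtually nilpotent.
    obtain ⟨F, hFf, -, hF⟩ := exists_finite_cover_of_relIndex_ne_zero hNi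
    refine relIndex_ne_zero_of_finite_cover
      (F := Set.image2 (fun (r : ℕ) f => t ^ r * f) (Set.Iio m) F)
      ((Set.finite_Iio _).image2 _ hFf) fun v hv => ?_
    obtain ⟨a, ha⟩ := ht v hv
    have hm1 : (m : ℤ) ≠ 0 := by omega
    have hr := Int.emod_nonneg (-a) hm1
    have hr' := Int.emod_lt_of_pos (-a) (show (0 : ℤ) < m by omega)
    have hdiv := Int.mul_ediv_add_emod (-a) m
    set q := (-a) / (m : ℤ)
    set e := (-a) % (m : ℤ)
    have hmem : t ^ (-e) * v * (t ^ m) ^ (-q) ∈ K := by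
      have h5 : t ^ (-e) * v * (t ^ m) ^ (-q) = t ^ (-e) * (v * t ^ a) * (t ^ (-e))⁻¹ := by
        rw [← zpow_natCast, ← zpow_mul]
        have h6 : (m : ℤ) * (-q) = a + e := by rw [mul_neg]; omega
        rw [h6, zpow_add]; group
      rw [h5]
      exact hstep.conj_mem ha (L.zpow_mem htL _)
    obtain ⟨f, hf, hfm⟩ := hF _ hmem
    refine ⟨_, ⟨e.toNat, by simp only [Set.mem_Iio]; omega, f, hf, rfl⟩, ?_⟩
    have h7 : (t ^ e.toNat * f)⁻¹ * v =
        f⁻¹ * (t ^ (-e) * v * (t ^ m) ^ (-q)) * (t ^ m) ^ q := by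
      rw [← zpow_natCast t e.toNat, Int.toNat_of_nonneg hr]; group
    rw [h7]
    exact mul_mem_sup hfm (zpow_mem (mem_zpowers _) q)

/-! ## Automorphisms of finitely generated abelian groups -/

theorem IsNilpotent.pow_sub_one {R : Type*} [Ring R] {a : R} (h : IsNilpotent (a - 1)) (l : ℕ) :
    IsNilpotent (a ^ l - 1) := by
  have hS := (Commute.one_right a).geom_sum₂_mul l
  simp only [one_pow, mul_one] at hS
  rw [← hS]
  refine Commute.isNilpotent_mul_left ?_ h
  exact Commute.sum_left _ _ _ fun i _ =>
    ((Commute.refl a).pow_left i).sub_right (Commute.one_right _)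

section Dual

variable {V : Type*} [AddCommGroup V]

/-- Modulo torsion `V` is free, and the coordinates of a basis are among the functionals. -/
theorem exists_nsmul_eq_zero_of_forall_dual_eq_zero [Module.Finite ℤ V] {x : V}
    (h : ∀ f : V →ₗ[ℤ] ℚ, f x = 0) : ∃ m : ℕ, 0 < m ∧ m • x = 0 := by
  let b := Module.Free.chooseBasis ℤ (V ⧸ Submodule.torsion ℤ V)
  have h1 : (Submodule.torsion ℤ V).mkQ x = 0 := by
    rw [← b.repr.map_eq_zero_iff]
    ext i
    have h2 := h ((Algebra.linearMap ℤ ℚ).comp ((b.coord i).comp (Submodule.torsion ℤ V).mkQ))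
    simpa using h2
  rw [Submodule.mkQ_apply, Submodule.Quotient.mk_eq_zero, Submodule.mem_torsion_iff] at h1
  obtain ⟨a, ha⟩ := h1
  refine ⟨(a : ℤ).natAbs, Int.natAbs_pos.2 (nonZeroDivisors.ne_zero a.2), ?_⟩
  have ha' : (a : ℤ) • x = 0 := ha
  rcases Int.natAbs_eq (a : ℤ) with h | h
  · rw [h, natCast_zsmul] at ha'; exact ha'
  · rw [h, neg_smul, neg_eq_zero, natCast_zsmul] at ha'; exact ha'

/-- Precomposition with an endomorphism, on homomorphisms to a field. -/
def dualEnd (K : Type*) [Field K] (α : Module.End ℤ V) : Module.End K (V →ₗ[ℤ] K) where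
  toFun f := f.comp α
  map_add' _ _ := rfl
  map_smul' _ _ := rfl

theorem dualEnd_pow_apply {K : Type*} [Field K] (α : Module.End ℤ V) (k : ℕ) (f : V →ₗ[ℤ] K)
    (x : V) : (dualEnd K α ^ k) f x = f ((α ^ k) x) := by
  induction k generalizing f with
  | zero => simp
  | succ k ih =>
    rw [pow_succ, Module.End.mul_apply, ih, pow_succ', Module.End.mul_apply]
    rfl

theorem dualEnd_pow_sub_one_pow_apply {K : Type*} [Field K] (α : Module.End ℤ V) (k n : ℕ)
    (f : V →ₗ[ℤ] K) (x : V) :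
    ((dualEnd K α ^ k - 1) ^ n) f x = f (((α ^ k - 1) ^ n) x) := by
  induction n generalizing f with
  | zero => simp
  | succ n ih =>
    rw [pow_succ, Module.End.mul_apply, ih, pow_succ', Module.End.mul_apply]
    simp [LinearMap.sub_apply, dualEnd_pow_apply]

theorem finite_dual (K : Type*) [Field K] [Module.Finite ℤ V] : Module.Finite K (V →ₗ[ℤ] K) := by
  obtain ⟨S, hS⟩ := Module.Finite.fg_top (R := ℤ) (M := V)
  let F : (V →ₗ[ℤ] K) →ₗ[K] (S → K) :=
    { toFun := fun f s => f s
      map_add' := fun _ _ => rfl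
      map_smul' := fun _ _ => rfl }
  refine Module.Finite.of_injective F fun f g hfg => ?_
  exact LinearMap.ext_on hS fun s hs => congrFun hfg ⟨s, hs⟩

/-- A monic integer polynomial annihilating `α` also annihilates `μ`, because `f (p(α) x) = p(μ) * f
x`. -/
theorem isIntegral_of_eigenvector {K : Type*} [Field K] [Module.Finite ℤ V] {α : Module.End ℤ V}
    {f : V →ₗ[ℤ] K} (hf : f ≠ 0) {μ : K} (h : ∀ x, f (α x) = μ * f x) : IsIntegral ℤ μ := by
  obtain ⟨p, hp, hpα⟩ := LinearMap.exists_monic_and_aeval_eq_zero ℤ α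
  obtain ⟨x, hx⟩ : ∃ x, f x ≠ 0 := by
    by_contra! hcon
    exact hf (LinearMap.ext hcon)
  have h1 : ∀ (k : ℕ) (x : V), f ((α ^ k) x) = μ ^ k * f x := by
    intro k
    induction k with
    | zero => simp
    | succ k ih => intro x; rw [pow_succ', Module.End.mul_apply, h, ih]; ring
  have h2 : ∀ q : Polynomial ℤ, f (Polynomial.aeval α q x) = Polynomial.aeval μ q * f x := by
    intro q
    induction q using Polynomial.induction_on' with
    | add p q hp hq => simp only [map_add, LinearMap.add_apply, hp, hq, add_mul]
    | monomial n a =>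
      rw [Polynomial.aeval_monomial, Polynomial.aeval_monomial, Module.End.mul_apply,
        Module.algebraMap_end_apply, map_smul, h1, algebraMap_int_eq, eq_intCast, zsmul_eq_mul,
        mul_assoc]
  refine ⟨p, hp, ?_⟩
  have h3 := h2 p
  rw [hpα, LinearMap.zero_apply, map_zero] at h3
  exact (mul_eq_zero.1 h3.symm).resolve_right hx

/-- Either some complex homomorphism is an eigenvector whose eigenvalue is not of modulus one, or
some power acts unipotently on homomorphisms to an algebraically closed field. -/
theorem exists_eigenvector_or_unipotent [Module.Finite ℤ V] (α : Module.End ℤ V) :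
    (∃ (μ : ℂ) (f : V →ₗ[ℤ] ℂ), f ≠ 0 ∧ ‖μ‖ ≠ 1 ∧ ∀ x, f (α x) = μ * f x) ∨
    ∃ k n : ℕ, 0 < k ∧ (dualEnd (AlgebraicClosure ℚ) α ^ k - 1) ^ n = 0 := by
  by_cases hcon : ∃ (μ : ℂ) (f : V →ₗ[ℤ] ℂ), f ≠ 0 ∧ ‖μ‖ ≠ 1 ∧ ∀ x, f (α x) = μ * f x
  · exact Or.inl hcon
  refine Or.inr ?_
  replace hcon : ∀ (μ : ℂ) (f : V →ₗ[ℤ] ℂ), f ≠ 0 → (∀ x, f (α x) = μ * f x) → ‖μ‖ = 1 :=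
    fun μ f hf h => by_contra fun hμ => hcon ⟨μ, f, hf, hμ, h⟩
  have := finite_dual (V := V) (AlgebraicClosure ℚ)
  set T := dualEnd (AlgebraicClosure ℚ) α with hT
  have hroot : ∀ μ ∈ (minpoly (AlgebraicClosure ℚ) T).roots, ∃ k : ℕ, 0 < k ∧ μ ^ k = 1 := by
    intro μ hμ
    obtain ⟨f, hf⟩ := (Module.End.hasEigenvalue_iff_isRoot.2
      (Polynomial.isRoot_of_mem_roots hμ)).exists_hasEigenvector
    have hfμ : ∀ x, f (α x) = μ * f x := fun x => LinearMap.congr_fun hf.apply_eq_smul x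
    have hint := isIntegral_of_eigenvector hf.2 hfμ
    have hintQ : IsIntegral ℚ μ := hint.tower_top
    have := IntermediateField.adjoin.finiteDimensional hintQ
    have : NumberField (IntermediateField.adjoin ℚ {μ}) := ⟨⟩
    have : Algebra.IsAlgebraic ℚ (AlgebraicClosure ℚ) := by
      convert AlgebraicClosure.isAlgebraic ℚ
      all_goals rfl
    have := Algebra.IsAlgebraic.tower_top (K := ℚ) (IntermediateField.adjoin ℚ {μ})
      (A := AlgebraicClosure ℚ)
    let g := IntermediateField.AdjoinSimple.gen ℚ μ
    have hg : algebraMap _ (AlgebraicClosure ℚ) g = μ :=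
      IntermediateField.AdjoinSimple.algebraMap_gen ℚ μ
    have hgint : IsIntegral ℤ g := by
      rw [← hg] at hint
      exact (isIntegral_algebraMap_iff (algebraMap (IntermediateField.adjoin ℚ {μ})
        (AlgebraicClosure ℚ)).injective).1 hint
    -- Kronecker's theorem. An embedding `ψ` of `ℚ(μ)` extends to the algebraic closure and turns
    -- `f` into a complex eigenvector with eigenvalue `ψ(μ)`, so every conjugate of `μ` has modulus
    -- one. This is why eigenvectors are first taken over `AlgebraicClosure ℚ`.
    obtain ⟨k, hk, hgk⟩ := NumberField.Embeddings.pow_eq_one_of_norm_eq_one _ ℂ hgint (by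
      intro ψ
      let _ : Algebra (IntermediateField.adjoin ℚ {μ}) ℂ := ψ.toAlgebra
      let Ψ : AlgebraicClosure ℚ →ₐ[IntermediateField.adjoin ℚ {μ}] ℂ := IsAlgClosed.lift
      refine hcon (ψ g) ((Ψ : AlgebraicClosure ℚ →+* ℂ).toAddMonoidHom.toIntLinearMap.comp f)
        (fun h0 => hf.2 ?_) fun x => ?_
      · ext x
        have h1 := LinearMap.congr_fun h0 x
        exact (map_eq_zero (Ψ : AlgebraicClosure ℚ →+* ℂ)).1 h1
      · change Ψ (f (α x)) = ψ g * Ψ (f x)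
        have h2 : Ψ μ = ψ g := (congrArg Ψ hg.symm).trans (Ψ.commutes g)
        rw [hfμ, map_mul, h2])
    refine ⟨k, hk, ?_⟩
    rw [← hg, ← map_pow, hgk, map_one]
  choose! k hk0 hk using hroot
  classical
  set R := (minpoly (AlgebraicClosure ℚ) T).roots
  refine ⟨∏ μ ∈ R.toFinset, k μ, R.card,
    Finset.prod_pos fun μ hμ => hk0 μ (Multiset.mem_toFinset.1 hμ), ?_⟩
  set m := ∏ μ ∈ R.toFinset, k μ
  have hdvd : minpoly (AlgebraicClosure ℚ) T ∣ (Polynomial.X ^ m - 1) ^ R.card := by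
    rw [(IsAlgClosed.splits (minpoly (AlgebraicClosure ℚ) T)).eq_prod_roots_of_monic
      (minpoly.monic (Algebra.IsIntegral.isIntegral T)), ← Multiset.prod_replicate,
      ← Multiset.map_const']
    refine Multiset.prod_dvd_prod_of_dvd _ _ fun μ hμ => ?_
    rw [Polynomial.dvd_iff_isRoot, Polynomial.IsRoot.def]
    obtain ⟨c, hc⟩ : k μ ∣ m := Finset.dvd_prod_of_mem k (Multiset.mem_toFinset.2 hμ)
    simp [hc, pow_mul, hk μ hμ]
  obtain ⟨q, hq⟩ := hdvd
  have h2 := congrArg (Polynomial.aeval T) hq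
  simpa [minpoly.aeval] using h2

/-- Either some complex homomorphism is an eigenvector whose eigenvalue is not of modulus one, or
some power of the automorphism is unipotent. -/
theorem exists_eigenvector_or_isNilpotent [Module.Finite ℤ V] {α : Module.End ℤ V}
    (hα : Function.Injective α) :
    (∃ (μ : ℂ) (f : V →ₗ[ℤ] ℂ), f ≠ 0 ∧ ‖μ‖ ≠ 1 ∧ ∀ x, f (α x) = μ * f x) ∨
    ∃ k : ℕ, 0 < k ∧ IsNilpotent (α ^ k - 1) := by
  refine (exists_eigenvector_or_unipotent α).imp_right ?_
  rintro ⟨k, n, hk, h⟩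
  -- Functionals do not see torsion: unipotence on the dual only puts the image of `(α ^ k - 1) ^ n`
  -- inside `W`. As `W` is finite, a power `α ^ l` is the identity there.
  let W := Submodule.torsion ℤ V
  have hW : Finite W := Module.finite_of_fg_torsion _ (Submodule.torsion_isTorsion)
  have hαW : ∀ x ∈ W, α x ∈ W := by
    intro x hx
    rw [Submodule.mem_torsion_iff] at hx ⊢
    obtain ⟨a, ha⟩ := hx
    refine ⟨a, ?_⟩
    have ha' : (a : ℤ) • x = 0 := ha
    change (a : ℤ) • α x = 0
    rw [← map_smul, ha', map_zero]
  have hinj : Function.Injective (α.restrict hαW) := fun x y hxy =>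
    Subtype.ext (hα (congrArg Subtype.val hxy))
  obtain ⟨l, hl, hlW⟩ : ∃ l : ℕ, 0 < l ∧ ∀ x ∈ W, (α ^ l) x = x := by
    let e : Equiv.Perm W := Equiv.ofBijective _ (Finite.injective_iff_bijective.1 hinj)
    refine ⟨orderOf e, orderOf_pos e, fun x hx => ?_⟩
    have h1 : ∀ j : ℕ, ∀ y : W, (((e ^ j) y : W) : V) = (α ^ j) y := by
      intro j
      induction j with
      | zero => simp
      | succ j ih =>
        intro y
        rw [pow_succ, Equiv.Perm.mul_apply, ih, pow_succ, Module.End.mul_apply]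
        rfl
    have h2 := h1 (orderOf e) ⟨x, hx⟩
    rw [pow_orderOf_eq_one] at h2
    exact h2.symm
  refine ⟨k * l, mul_pos hk hl, n + 1, ?_⟩
  have hS := (Commute.one_right (α ^ k)).geom_sum₂_mul l
  simp only [one_pow, mul_one] at hS
  set S := ∑ i ∈ Finset.range l, (α ^ k) ^ i
  have hcomm : Commute S (α ^ k - 1) :=
    Commute.sum_left _ _ _ fun i _ =>
      ((Commute.refl (α ^ k)).pow_left i).sub_right (Commute.one_right _)
  have hcomm' : Commute (α ^ (k * l) - 1) (S ^ n) := by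
    rw [pow_mul, ← hS]
    exact ((Commute.refl S).mul_left hcomm.symm).pow_right n
  -- The first `n` factors contribute `(α ^ k - 1) ^ n`, landing in `W`; the extra one kills `W`.
  have h1 : (α ^ (k * l) - 1) ^ (n + 1) =
      S ^ n * ((α ^ (k * l) - 1) * (α ^ k - 1) ^ n) := by
    rw [← mul_assoc, ← hcomm'.eq, mul_assoc, ← hcomm.mul_pow, hS, ← pow_mul, pow_succ']
  rw [h1]
  ext x
  have h2 : ((α ^ k - 1) ^ n) x ∈ W := by
    obtain ⟨m, hm, hmx⟩ := exists_nsmul_eq_zero_of_forall_dual_eq_zero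
      (x := ((α ^ k - 1) ^ n) x) (fun f => by
        let f' : V →ₗ[ℤ] AlgebraicClosure ℚ :=
          (algebraMap ℚ (AlgebraicClosure ℚ)).toAddMonoidHom.toIntLinearMap.comp f
        have h3 := dualEnd_pow_sub_one_pow_apply α k n f' x
        rw [h, LinearMap.zero_apply, LinearMap.zero_apply] at h3
        exact (map_eq_zero (algebraMap ℚ (AlgebraicClosure ℚ))).1 h3.symm)
    rw [Submodule.mem_torsion_iff]
    refine ⟨⟨(m : ℤ), mem_nonZeroDivisors_of_ne_zero (by omega)⟩, ?_⟩
    change (m : ℤ) • ((α ^ k - 1) ^ n) x = 0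
    rw [natCast_zsmul]
    exact hmx
  have h4 : ∀ j : ℕ, ∀ y ∈ W, ((α ^ l) ^ j) y = y := by
    intro j y hy
    induction j with
    | zero => simp
    | succ j ih => rw [pow_succ, Module.End.mul_apply, hlW y hy, ih]
  rw [Module.End.mul_apply, Module.End.mul_apply, LinearMap.sub_apply, mul_comm k l, pow_mul,
    h4 k _ h2]
  simp

end Dual

/-! ## A nilpotency criterion -/

open Subgroup in
-- The elements commuting with `x` modulo the `n`-th term form a subgroup, so generators suffice.
theorem mem_upperCentralSeries_succ_of_closure {E : Type*} [Group E] {T : Set E}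
    (hT : closure T = ⊤) {n : ℕ} {x : E}
    (h : ∀ e ∈ T, ⁅e, x⁆ ∈ Subgroup.upperCentralSeries E n) :
    x ∈ Subgroup.upperCentralSeries E (n + 1) := by
  let π := QuotientGroup.mk' (Subgroup.upperCentralSeries E n)
  have h1 : ∀ e, ⁅e, x⁆ ∈ Subgroup.upperCentralSeries E n ↔
      e ∈ (centralizer {π x}).comap π := by
    intro e
    rw [mem_comap, mem_centralizer_singleton_iff, ← commutatorElement_eq_one_iff_mul_comm,
      ← map_commutatorElement]
    exact (QuotientGroup.eq_one_iff _).symm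
  have h2 : closure T ≤ (centralizer {π x}).comap π :=
    (closure_le _).2 fun e he => (h1 e).1 (h e he)
  rw [Subgroup.mem_upperCentralSeries_succ_iff]
  intro y
  rw [← commutatorElement_inv, inv_mem_iff, h1]
  exact h2 (hT ▸ mem_top y)

open Subgroup in
/-- If `E` is generated by a nilpotent subgroup `N` and an element `s` normalizing `N` and acting
unipotently on the factors of its lower central series, then `E` is nilpotent. -/
theorem isNilpotent_of_unipotent {E : Type*} [Group E] {N : Subgroup E} {s : E}
    (hE : closure ((N : Set E) ∪ {s}) = ⊤)
    (hs : ∀ i, ∀ x ∈ N.lowerCentralSeries i, s * x * s⁻¹ ∈ N.lowerCentralSeries i)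
    {n : ℕ} (hn : N.lowerCentralSeries n = ⊥)
    (hu : ∀ i < n, ∃ r : ℕ, ∀ x ∈ N.lowerCentralSeries i,
      (fun y => ⁅s, y⁆)^[r] x ∈ N.lowerCentralSeries (i + 1)) : Group.IsNilpotent E := by
  have hcomm : ∀ i, ∀ x ∈ N.lowerCentralSeries i, ⁅s, x⁆ ∈ N.lowerCentralSeries i :=
    fun i x hx => (N.lowerCentralSeries i).mul_mem (hs i x hx) (inv_mem hx)
  have key : ∀ j ≤ n, ∃ m, N.lowerCentralSeries (n - j) ≤ Subgroup.upperCentralSeries E m := by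
    intro j
    induction j with
    | zero => exact fun _ => ⟨0, by rw [Nat.sub_zero, hn]; exact bot_le⟩
    | succ j ih =>
      intro hj
      obtain ⟨m, hm⟩ := ih (by omega)
      obtain ⟨i, hi⟩ : ∃ i, n - (j + 1) = i := ⟨_, rfl⟩
      rw [show n - j = i + 1 by omega] at hm
      rw [hi]
      obtain ⟨r, hr⟩ := hu i (by omega)
      -- A commutator with `N` falls into the next lower central term at once; commutators with `s`
      -- do so after `r` iterations. Each iteration costs one step of the upper central series of
      -- `E`.
      have hstep : ∀ r : ℕ, ∀ x ∈ N.lowerCentralSeries i,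
          (fun y => ⁅s, y⁆)^[r] x ∈ N.lowerCentralSeries (i + 1) →
          x ∈ Subgroup.upperCentralSeries E (m + r) := by
        intro r
        induction r with
        | zero => exact fun x _ hx => hm hx
        | succ r ihr =>
          intro x hx hxr
          refine mem_upperCentralSeries_succ_of_closure hE ?_
          rintro e (he | rfl)
          · refine Subgroup.upperCentralSeries_mono E (Nat.le_add_right m r) (hm ?_)
            rw [← commutatorElement_inv, inv_mem_iff]
            exact commutator_mem_commutator hx he
          · exact ihr _ (hcomm i x hx) hxr
      exact ⟨m + r, fun x hx => hstep r x hx (hr x hx)⟩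
  obtain ⟨m, hm⟩ := key n le_rfl
  rw [Nat.sub_self, Subgroup.lowerCentralSeries_zero] at hm
  refine ⟨⟨m + 1, ?_⟩⟩
  rw [eq_top_iff, ← hE, closure_le]
  rintro x (hx | rfl)
  · exact Subgroup.upperCentralSeries_mono E m.le_succ (hm hx)
  · refine mem_upperCentralSeries_succ_of_closure hE ?_
    rintro e (he | rfl)
    · refine hm ?_
      rw [← commutatorElement_inv, inv_mem_iff]
      exact hcomm 0 e he
    · rw [commutatorElement_self]
      exact one_mem _

/-! ## Homomorphisms to `ℂ` that are eigenvectors of a conjugation -/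

/-- The automorphism of `M` induced by conjugation by a normalizing element. -/
noncomputable def conjEquiv {G : Type*} [Group G] {M : Subgroup G} {t : G}
    (h : M.map (MulAut.conj t).toMonoidHom = M) : M ≃* M :=
  ((MulAut.conj t).subgroupMap M).trans (MulEquiv.subgroupCongr h)

theorem coe_conjEquiv_pow {G : Type*} [Group G] {M : Subgroup G} {t : G}
    (h : M.map (MulAut.conj t).toMonoidHom = M) (k : ℕ) (x : M) :
    ((conjEquiv h ^ k : MulAut M) x : G) = t ^ k * x * (t ^ k)⁻¹ := by
  induction k with
  | zero => simp
  | succ k ih =>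
    rw [pow_succ', MulAut.mul_apply, pow_succ', mul_inv_rev]
    change t * ((conjEquiv h ^ k : MulAut M) x : G) * t⁻¹ = _
    rw [ih]
    group

theorem map_conj_pow {G : Type*} [Group G] {M : Subgroup G} {t : G}
    (h : M.map (MulAut.conj t).toMonoidHom = M) (k : ℕ) :
    M.map (MulAut.conj (t ^ k)).toMonoidHom = M := by
  apply le_antisymm
  · rintro _ ⟨x, hx, rfl⟩
    have h1 := coe_conjEquiv_pow h k ⟨x, hx⟩
    change t ^ k * x * (t ^ k)⁻¹ ∈ M
    rw [← h1]
    exact Subtype.coe_prop _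
  · intro x hx
    refine ⟨((conjEquiv h ^ k : MulAut M)⁻¹ ⟨x, hx⟩ : M), Subtype.coe_prop _, ?_⟩
    have h1 := coe_conjEquiv_pow h k ((conjEquiv h ^ k : MulAut M)⁻¹ ⟨x, hx⟩)
    rw [MulAut.apply_inv_self] at h1
    exact h1.symm

/-- `ℓ` is a nonzero homomorphism from `M` to `ℂ`, and conjugation by `t` multiplies it by `μ`. -/
structure IsEigenHom {G : Type*} [Group G] (M : Subgroup G) (t : G) (ℓ : G → ℂ) (μ : ℂ) :
    Prop where
  map_conj : M.map (MulAut.conj t).toMonoidHom = M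
  map_mul : ∀ x ∈ M, ∀ y ∈ M, ℓ (x * y) = ℓ x + ℓ y
  conj : ∀ x ∈ M, ℓ (t * x * t⁻¹) = μ * ℓ x
  exists_ne_zero : ∃ x ∈ M, ℓ x ≠ 0

namespace IsEigenHom

variable {G : Type*} [Group G] {M : Subgroup G} {t : G} {ℓ : G → ℂ} {μ : ℂ}

theorem map_one (h : IsEigenHom M t ℓ μ) : ℓ 1 = 0 := by
  have := h.map_mul 1 M.one_mem 1 M.one_mem
  simpa using this

theorem map_inv (h : IsEigenHom M t ℓ μ) {x : G} (hx : x ∈ M) : ℓ x⁻¹ = -ℓ x := by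
  have h1 := h.map_mul x hx x⁻¹ (M.inv_mem hx)
  rw [mul_inv_cancel, h.map_one] at h1
  exact eq_neg_of_add_eq_zero_right h1.symm

theorem map_pow (h : IsEigenHom M t ℓ μ) {x : G} (hx : x ∈ M) (n : ℕ) : ℓ (x ^ n) = n * ℓ x := by
  induction n with
  | zero => simp [h.map_one]
  | succ n ih => rw [pow_succ, h.map_mul _ (M.pow_mem hx n) _ hx, ih]; push_cast; ring

theorem conj_mem (h : IsEigenHom M t ℓ μ) {x : G} (hx : x ∈ M) : t * x * t⁻¹ ∈ M := by
  have h1 : MulAut.conj t x ∈ M.map (MulAut.conj t).toMonoidHom := ⟨x, hx, rfl⟩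
  rwa [h.map_conj] at h1

theorem eigenvalue_ne_zero (h : IsEigenHom M t ℓ μ) : μ ≠ 0 := by
  rintro rfl
  obtain ⟨x, hx, hx0⟩ := h.exists_ne_zero
  have hx' := hx
  rw [← h.map_conj] at hx'
  obtain ⟨y, hy, rfl⟩ := hx'
  have h1 := h.conj y hy
  rw [zero_mul] at h1
  exact hx0 h1

theorem conj_pow (h : IsEigenHom M t ℓ μ) (k : ℕ) {x : G} (hx : x ∈ M) :
    ℓ (t ^ k * x * (t ^ k)⁻¹) = μ ^ k * ℓ x := by
  induction k with
  | zero => simp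
  | succ k ih =>
    have h1 : t ^ (k + 1) * x * (t ^ (k + 1))⁻¹ = t * (t ^ k * x * (t ^ k)⁻¹) * t⁻¹ := by
      rw [pow_succ']; group
    have h2 : t ^ k * x * (t ^ k)⁻¹ ∈ M := by
      have h3 : MulAut.conj (t ^ k) x ∈ M.map (MulAut.conj (t ^ k)).toMonoidHom := ⟨x, hx, rfl⟩
      rwa [map_conj_pow h.map_conj] at h3
    rw [h1, h.conj _ h2, ih]
    ring

protected theorem pow (h : IsEigenHom M t ℓ μ) (k : ℕ) : IsEigenHom M (t ^ k) ℓ (μ ^ k) :=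
  ⟨map_conj_pow h.map_conj k, h.map_mul, fun _ hx => h.conj_pow k hx, h.exists_ne_zero⟩

/-- Turns a contracting eigenvalue into an expanding one. -/
protected theorem inv (h : IsEigenHom M t ℓ μ) : IsEigenHom M t⁻¹ ℓ μ⁻¹ := by
  have h1 : M.map (MulAut.conj t⁻¹).toMonoidHom = M := by
    conv_lhs => rw [← h.map_conj, Subgroup.map_map]
    convert M.map_id
    ext x
    simp [mul_assoc]
  refine ⟨h1, h.map_mul, fun x hx => ?_, h.exists_ne_zero⟩
  have h2 : t⁻¹ * x * t⁻¹⁻¹ ∈ M := by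
    have h3 : MulAut.conj t⁻¹ x ∈ M.map (MulAut.conj t⁻¹).toMonoidHom := ⟨x, hx, rfl⟩
    rwa [h1] at h3
  have h4 := h.conj _ h2
  rw [show t * (t⁻¹ * x * t⁻¹⁻¹) * t⁻¹ = x by group] at h4
  rw [h4, inv_mul_cancel_left₀ h.eigenvalue_ne_zero]

end IsEigenHom

/-- The abelianization, as an additive group. -/
abbrev AddAb (M : Type*) [Group M] : Type _ := Additive (Abelianization M)

/-- The class of an element in the abelianization. -/
def addAbOf {M : Type*} [Group M] (x : M) : AddAb M := Additive.ofMul (Abelianization.of x)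

theorem addAbOf_mul {M : Type*} [Group M] (x y : M) : addAbOf (x * y) = addAbOf x + addAbOf y := rfl

theorem addAbOf_surjective (M : Type*) [Group M] : Function.Surjective (addAbOf (M := M)) :=
  QuotientGroup.mk_surjective

theorem addAbOf_eq_zero_iff {M : Type*} [Group M] {x : M} :
    addAbOf x = 0 ↔ x ∈ commutator M := by
  rw [← Abelianization.ker_of]
  exact Iff.rfl

theorem finite_addAb (M : Type*) [Group M] [Group.FG M] : Module.Finite ℤ (AddAb M) := by
  have : Group.FG (Abelianization M) :=
    Group.fg_of_surjective (f := Abelianization.of) QuotientGroup.mk_surjective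
  exact Module.Finite.iff_addGroup_fg.2 inferInstance

/-- The endomorphism of the abelianization induced by an endomorphism. -/
def addAbEnd {M : Type*} [Group M] (φ : M →* M) : Module.End ℤ (AddAb M) :=
  (MonoidHom.toAdditive (Abelianization.map φ)).toIntLinearMap

/-- Either conjugation by `t` has an eigenvalue of modulus different from one on homomorphisms
`M → ℂ`, or some power of `t` acts unipotently on the abelianization of `M`. -/
theorem exists_isEigenHom_or_unipotent {G : Type*} [Group G] {M : Subgroup G} {t : G}
    (hM : M.FG) (h : M.map (MulAut.conj t).toMonoidHom = M) :
    (∃ ℓ μ, IsEigenHom M t ℓ μ ∧ ‖μ‖ ≠ 1) ∨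
    ∃ k : ℕ, 0 < k ∧ ∀ l : ℕ, ∃ r : ℕ, ∀ x ∈ M, (fun y => ⁅t ^ (k * l), y⁆)^[r] x ∈ ⁅M, M⁆ := by
  classical
  have : Group.FG M := (Group.fg_iff_subgroup_fg M).2 hM
  have := finite_addAb M
  let α := addAbEnd (conjEquiv h).toMonoidHom
  have hα : Function.Injective α :=
    (MulEquiv.abelianizationCongr (conjEquiv h)).injective
  rcases exists_eigenvector_or_isNilpotent hα with ⟨μ, f, hf, hμ, hfμ⟩ | ⟨k, hk, hnil⟩
  · left
    -- The value `0` outside `M` is immaterial.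
    refine ⟨fun g => if hg : g ∈ M then f (addAbOf ⟨g, hg⟩) else 0, μ, ⟨h, ?_, ?_, ?_⟩, hμ⟩
    · intro x hx y hy
      simp only [hx, hy, M.mul_mem hx hy, dif_pos]
      rw [← map_add, ← addAbOf_mul]
      rfl
    · intro x hx
      have h1 : t * x * t⁻¹ ∈ M := (conjEquiv h ⟨x, hx⟩).2
      simp only [hx, h1, dif_pos]
      exact hfμ (addAbOf ⟨x, hx⟩)
    · by_contra! hcon
      refine hf (LinearMap.ext fun v => ?_)
      obtain ⟨x, rfl⟩ := addAbOf_surjective M v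
      have h2 := hcon x x.2
      simpa using h2
  · right
    -- Allowing all multiples of `k` lets one exponent serve several subgroups at once.
    refine ⟨k, hk, fun l => ?_⟩
    obtain ⟨r, hr⟩ := hnil.pow_sub_one l
    refine ⟨r, fun x hx => ?_⟩
    have hpow : ∀ (j : ℕ) (y : M), (α ^ j) (addAbOf y) =
        addAbOf ((conjEquiv h ^ j : MulAut M) y) := by
      intro j
      induction j with
      | zero => exact fun _ => rfl
      | succ j ih =>
        intro y
        rw [pow_succ, Module.End.mul_apply, pow_succ, MulAut.mul_apply, ← ih]
        rfl
    -- On the abelianization, `y ↦ ⁅t ^ (k * l), y⁆` becomes `α ^ (k * l) - 1`.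
    have key : ∀ (r : ℕ) (y : M), ∃ z : M, (z : G) = (fun y => ⁅t ^ (k * l), y⁆)^[r] (y : G) ∧
        addAbOf z = (((α ^ k) ^ l - 1) ^ r) (addAbOf y) := by
      intro r
      induction r with
      | zero => exact fun y => ⟨y, rfl, rfl⟩
      | succ r ih =>
        intro y
        obtain ⟨z, hz, hz'⟩ := ih ((conjEquiv h ^ (k * l) : MulAut M) y * y⁻¹)
        refine ⟨z, ?_, ?_⟩
        · rw [hz, Function.iterate_succ_apply, Subgroup.coe_mul, coe_conjEquiv_pow]
          rfl
        · rw [hz', pow_succ, Module.End.mul_apply, addAbOf_mul, ← hpow, pow_mul]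
          congr 1
          rw [LinearMap.sub_apply, Module.End.one_apply, sub_eq_add_neg]
          rfl
    obtain ⟨z, hz, hz'⟩ := key r ⟨x, hx⟩
    rw [hr, LinearMap.zero_apply, addAbOf_eq_zero_iff] at hz'
    rw [← hz, ← Subgroup.map_subtype_commutator]
    exact Subgroup.mem_map_of_mem _ hz'

open Subgroup in
/-- A polycyclic group that is not virtually nilpotent contains a nilpotent subgroup with an
expanding homomorphism to `ℂ`. -/
theorem IsPolycyclic.exists_isEigenHom {G : Type*} [Group G] (hG : IsPolycyclic G)
    (hv : ¬ Group.IsVirtuallyNilpotent G) :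
    ∃ (M : Subgroup G) (t : G) (ℓ : G → ℂ) (μ : ℂ), Group.IsNilpotent M ∧ IsEigenHom M t ℓ μ ∧
      1 < ‖μ‖ := by
  obtain ⟨N, t, hN, hNt, hnot⟩ := hG.exists_nilpotent_of_not_isVirtuallyNilpotent hv
  have hlt : ∀ i, (N.lowerCentralSeries i).map (MulAut.conj t).toMonoidHom =
      N.lowerCentralSeries i := fun i => by rw [map_lowerCentralSeries, hNt]
  by_cases hex : ∃ i ℓ μ, IsEigenHom (N.lowerCentralSeries i) t ℓ μ ∧ ‖μ‖ ≠ 1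
  · obtain ⟨i, ℓ, μ, h, hμ⟩ := hex
    have hnil : Group.IsNilpotent (N.lowerCentralSeries i) := by
      have h1 : N.lowerCentralSeries i ≤ N := lowerCentralSeries_le_self N i
      exact (Group.isNilpotent_congr (subgroupOfEquivOfLe h1)).1 inferInstance
    rcases lt_or_gt_of_ne hμ with h1 | h1
    · refine ⟨_, t⁻¹, ℓ, μ⁻¹, hnil, h.inv, ?_⟩
      rw [norm_inv]
      exact (one_lt_inv₀ (norm_pos_iff.2 h.eigenvalue_ne_zero)).2 h1
    · exact ⟨_, t, ℓ, μ, hnil, h, h1⟩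
  · exfalso
    have hu := fun i => (exists_isEigenHom_or_unipotent (hG.subgroup_fg _) (hlt i)).resolve_left
      fun ⟨ℓ, μ, h⟩ => hex ⟨i, ℓ, μ, h⟩
    choose k hk0 hk using hu
    obtain ⟨n, hn⟩ : ∃ n, N.lowerCentralSeries n = ⊥ :=
      (isNilpotent_iff_lowerCentralSeries N).1 hN
    -- A common exponent for all lower central terms of `N`; it makes `N ⊔ zpowers (t ^ K)`
    -- nilpotent, contrary to the choice of `N` and `t`.
    set K := ∏ i ∈ Finset.range n, k i
    refine hnot K (Finset.prod_pos fun i _ => hk0 i) ?_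
    set s := t ^ K
    set E := N ⊔ zpowers s
    have hNE : N ≤ E := le_sup_left
    have hsE : s ∈ E := le_sup_right (a := N) (mem_zpowers s)
    have hmap : (N.subgroupOf E).map E.subtype = N := by
      rw [subgroupOf_map_subtype, inf_eq_left.2 hNE]
    have hlcs : ∀ (i : ℕ) (x : E), x ∈ (N.subgroupOf E).lowerCentralSeries i ↔
        (x : G) ∈ N.lowerCentralSeries i := by
      intro i x
      conv_rhs => rw [← hmap, ← map_lowerCentralSeries]
      exact (mem_map_iff_mem E.subtype_injective).symm
    refine isNilpotent_of_unipotent (N := N.subgroupOf E) (s := ⟨s, hsE⟩) (n := n) ?_ ?_ ?_ ?_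
    · apply map_injective E.subtype_injective
      rw [MonoidHom.map_closure, ← MonoidHom.range_eq_map, range_subtype, Set.image_union,
        Set.image_singleton, Subgroup.closure_union, ← Subgroup.coe_map, closure_eq, hmap,
        ← zpowers_eq_closure]
      rfl
    · intro i x hx
      rw [hlcs] at hx ⊢
      have h2 : MulAut.conj s x ∈ (N.lowerCentralSeries i).map (MulAut.conj s).toMonoidHom :=
        ⟨x, hx, rfl⟩
      rwa [map_conj_pow (hlt i)] at h2
    · rw [eq_bot_iff]
      intro x hx
      rw [hlcs, hn, mem_bot] at hx
      exact Subtype.ext hx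
    · intro i hi
      obtain ⟨l, hl⟩ : k i ∣ K := Finset.dvd_prod_of_mem k (Finset.mem_range.2 hi)
      obtain ⟨r, hr⟩ := hk i l
      refine ⟨r, fun x hx => ?_⟩
      rw [hlcs] at hx ⊢
      have h3 := hr x hx
      rw [← hl] at h3
      have h4 : ∀ (r : ℕ) (x : E), (((fun y => ⁅(⟨s, hsE⟩ : E), y⁆)^[r] x : E) : G) =
          (fun y => ⁅s, y⁆)^[r] (x : G) := by
        intro r
        induction r with
        | zero => exact fun _ => rfl
        | succ r ih => intro x; rw [Function.iterate_succ_apply, ih]; rfl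
      rw [h4]
      exact commutator_mono le_rfl (lowerCentralSeries_le_self N i) h3

/-! ## Rational homomorphisms vanishing on a subgroup -/

/-- The rational homomorphisms vanishing on a subgroup. -/
def perp {M : Type*} [Group M] (D : Subgroup M) : Submodule ℚ (AddAb M →ₗ[ℤ] ℚ) where
  carrier := {f | ∀ d ∈ D, f (addAbOf d) = 0}
  add_mem' := fun hf hg d hd => by rw [LinearMap.add_apply, hf d hd, hg d hd, add_zero]
  zero_mem' := fun _ _ => rfl
  smul_mem' := fun c f hf d hd => by rw [LinearMap.smul_apply, hf d hd, smul_zero]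

theorem mem_perp {M : Type*} [Group M] {D : Subgroup M} {f : AddAb M →ₗ[ℤ] ℚ} :
    f ∈ perp D ↔ ∀ d ∈ D, f (addAbOf d) = 0 := Iff.rfl

theorem perp_antitone {M : Type*} [Group M] {D E : Subgroup M} (h : D ≤ E) : perp E ≤ perp D :=
  fun _ hf d hd => hf d (h hd)

theorem perp_sup {M : Type*} [Group M] (D E : Subgroup M) : perp (D ⊔ E) = perp D ⊓ perp E := by
  refine le_antisymm (le_inf (perp_antitone le_sup_left) (perp_antitone le_sup_right)) ?_
  intro f hf d hd
  rw [Subgroup.sup_eq_closure] at hd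
  induction hd using Subgroup.closure_induction with
  | mem x hx => exact hx.elim (hf.1 x) (hf.2 x)
  | one => exact map_zero f
  | mul x y _ _ hx hy => rw [addAbOf_mul, map_add, hx, hy, add_zero]
  | inv x _ hx =>
    have h1 : addAbOf x⁻¹ = -addAbOf x := rfl
    rw [h1, map_neg, hx, neg_zero]

theorem mem_perp_map {M : Type*} [Group M] {D : Subgroup M} (φ : M →* M)
    {f : AddAb M →ₗ[ℤ] ℚ} : f ∈ perp (D.map φ) ↔ dualEnd ℚ (addAbEnd φ) f ∈ perp D := by
  rw [mem_perp, mem_perp]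
  constructor
  · intro h d hd
    exact h _ (Subgroup.mem_map_of_mem φ hd)
  · rintro h _ ⟨d, hd, rfl⟩
    exact h d hd

theorem dualEnd_addAbEnd_injective {M : Type*} [Group M] (φ : M ≃* M) :
    Function.Injective (dualEnd ℚ (addAbEnd φ.toMonoidHom)) := by
  intro f g hfg
  refine LinearMap.ext fun v => ?_
  obtain ⟨x, rfl⟩ := addAbOf_surjective M v
  have h := LinearMap.congr_fun hfg (addAbOf (φ.symm x))
  change f (addAbOf (φ (φ.symm x))) = g (addAbOf (φ (φ.symm x))) at h
  rwa [φ.apply_symm_apply] at h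

theorem finrank_perp_map_le {M : Type*} [Group M] [Group.FG M] (D : Subgroup M) (φ : M ≃* M) :
    Module.finrank ℚ (perp (D.map φ.toMonoidHom)) ≤ Module.finrank ℚ (perp D) := by
  have := finite_addAb M
  have := finite_dual (V := AddAb M) ℚ
  refine LinearMap.finrank_le_finrank_of_injective
    (f := (dualEnd ℚ (addAbEnd φ.toMonoidHom)).restrict (p := perp (D.map φ.toMonoidHom))
      (q := perp D) fun f hf => (mem_perp_map _).1 hf) fun f g hfg => ?_
  exact Subtype.ext (dualEnd_addAbEnd_injective φ (congrArg Subtype.val hfg))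

/-- In a finitely generated nilpotent group, a subgroup on which no nonzero rational homomorphism
vanishes has finite index. -/
theorem finiteIndex_of_perp_eq_bot {M : Type*} [Group M] [Group.FG M] [Group.IsNilpotent M]
    {D : Subgroup M} (h : perp D = ⊥) : D.FiniteIndex := by
  have := finite_addAb M
  refine finiteIndex_of_forall_exists_pow_mem M inferInstance D
    (exists_pow_mem_of_sup_commutator fun x => ?_)
  -- A functional on the quotient by `W` pulls back into `perp D = ⊥`, so this quotient is torsion:
  -- each element has a power in `D ⊔ commutator M`.
  let W : Submodule ℤ (AddAb M) :=
    AddSubgroup.toIntSubmodule (Subgroup.toAddSubgroup (D.map Abelianization.of))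
  obtain ⟨m, hm, hx⟩ := exists_nsmul_eq_zero_of_forall_dual_eq_zero (x := W.mkQ (addAbOf x))
    (fun f => by
      have h1 : f.comp W.mkQ ∈ perp D := fun d hd => by
        have h2 : W.mkQ (addAbOf d) = 0 := by
          rw [Submodule.mkQ_apply, Submodule.Quotient.mk_eq_zero]
          exact Subgroup.mem_map_of_mem Abelianization.of hd
        rw [LinearMap.comp_apply, h2, map_zero]
      rw [h, Submodule.mem_bot] at h1
      exact LinearMap.congr_fun h1 (addAbOf x))
  refine ⟨m, hm, ?_⟩
  rw [← map_nsmul, Submodule.mkQ_apply, Submodule.Quotient.mk_eq_zero] at hx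
  have h3 : Abelianization.of (x ^ m) ∈ D.map Abelianization.of := by
    rw [map_pow]; exact hx
  rw [← Abelianization.ker_of, ← Subgroup.comap_map_eq]
  exact h3

/-! ## Confined stabilizers -/

/-- An irreducibility property: no proper rational subspace on which `ℓ` does not vanish is invariant
under a power of the conjugation by `t`. -/
def IsIrreducibleEigenHom {G : Type*} [Group G] (M : Subgroup G) (t : G) (ℓ : G → ℂ) (μ : ℂ) :
    Prop :=
  ∃ h : IsEigenHom M t ℓ μ, ∀ D : Subgroup M, (∃ d ∈ D, ℓ d ≠ 0) → ∀ j : ℕ, 0 < j →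
    perp (D.map (conjEquiv h.map_conj ^ j : MulAut M).toMonoidHom) = perp D → perp D = ⊥

/-- An expanding homomorphism on a subgroup of minimal Hirsch length is irreducible. -/
theorem IsPolycyclic.exists_isIrreducibleEigenHom {G : Type*} [Group G] (hG : IsPolycyclic G)
    (hv : ¬ Group.IsVirtuallyNilpotent G) :
    ∃ (M : Subgroup G) (t : G) (ℓ : G → ℂ) (μ : ℂ), Group.IsNilpotent M ∧
      IsIrreducibleEigenHom M t ℓ μ ∧ 1 < ‖μ‖ := by
  classical
  obtain ⟨hl, hhl⟩ := hG.exists_isHirschLength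
  have hex : ∃ n, ∃ (M : Subgroup G) (t : G) (ℓ : G → ℂ) (μ : ℂ), Group.IsNilpotent M ∧
      IsEigenHom M t ℓ μ ∧ 1 < ‖μ‖ ∧ hl M = n := by
    obtain ⟨M, t, ℓ, μ, h1, h2, h3⟩ := hG.exists_isEigenHom hv
    exact ⟨_, M, t, ℓ, μ, h1, h2, h3, rfl⟩
  obtain ⟨M, t, ℓ, μ, hM, h, hμ, hn⟩ := Nat.find_spec hex
  have hmin : ∀ (M' : Subgroup G) (s : G) (μ' : ℂ), Group.IsNilpotent M' →
      IsEigenHom M' s ℓ μ' → 1 < ‖μ'‖ → hl M ≤ hl M' := fun M' s μ' h1 h2 h3 => by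
    rw [hn]; exact Nat.find_min' hex ⟨M', s, ℓ, μ', h1, h2, h3, rfl⟩
  refine ⟨M, t, ℓ, μ, hM, ⟨h, fun D hD j hj hperp => ?_⟩, hμ⟩
  obtain ⟨d, hd, hd0⟩ := hD
  set ψ : MulAut M := conjEquiv h.map_conj ^ j with hψ
  have hinv : ∀ f : AddAb M →ₗ[ℤ] ℚ, f ∈ perp D ↔
      dualEnd ℚ (addAbEnd ψ.toMonoidHom) f ∈ perp D := by
    intro f
    rw [← mem_perp_map, hperp]
  -- The common kernel of `perp D` contains `D` and is invariant under `ψ`, so `ℓ` is still an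
  -- expanding eigenvector on it. By minimality `A` has finite index in `M`, and functionals
  -- vanishing on `A` are zero.
  let A : Subgroup M :=
    { carrier := {v | ∀ f ∈ perp D, f (addAbOf v) = 0}
      one_mem' := fun f _ => map_zero f
      mul_mem' := fun ha hb f hf => by
        rw [addAbOf_mul, map_add, ha f hf, hb f hf, add_zero]
      inv_mem' := fun {a} ha f hf => by
        have h1 : addAbOf a⁻¹ = -addAbOf a := rfl
        rw [h1, map_neg, ha f hf, neg_zero] }
  have hDA : D ≤ A := fun d hd f hf => hf d hd
  have hψA : ∀ v, ψ v ∈ A ↔ v ∈ A := by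
    intro v
    constructor
    · intro hv f hf
      have h1 : dualEnd ℚ (addAbEnd ψ.symm.toMonoidHom) f ∈ perp D := by
        rw [hinv]
        convert hf using 1
        refine LinearMap.ext fun v => ?_
        obtain ⟨x, rfl⟩ := addAbOf_surjective M v
        change f (addAbOf (ψ.symm (ψ x))) = f (addAbOf x)
        rw [ψ.symm_apply_apply]
      have h2 := hv _ h1
      change f (addAbOf (ψ.symm (ψ v))) = 0 at h2
      rwa [ψ.symm_apply_apply] at h2
    · intro hv f hf
      exact hv _ ((hinv f).1 hf)
  let M' : Subgroup G := A.map M.subtype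
  have hM'M : M' ≤ M := Subgroup.map_subtype_le A
  have hconj : M'.map (MulAut.conj (t ^ j)).toMonoidHom = M' := by
    ext x
    constructor
    · rintro ⟨_, ⟨v, hv, rfl⟩, rfl⟩
      exact ⟨ψ v, (hψA v).2 hv, coe_conjEquiv_pow h.map_conj j v⟩
    · rintro ⟨v, hv, rfl⟩
      refine ⟨_, ⟨ψ.symm v, ?_, rfl⟩, ?_⟩
      · refine (hψA _).1 ?_
        rwa [ψ.apply_symm_apply]
      · have h1 := coe_conjEquiv_pow h.map_conj j (ψ.symm v)
        rw [← hψ, ψ.apply_symm_apply] at h1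
        exact h1.symm
  have hM'n : Group.IsNilpotent M' :=
    (Group.isNilpotent_congr (A.equivMapOfInjective _ M.subtype_injective)).1 inferInstance
  have hj' := h.pow j
  have hM'e : IsEigenHom M' (t ^ j) ℓ (μ ^ j) :=
    ⟨hconj, fun x hx y hy => h.map_mul x (hM'M hx) y (hM'M hy), fun x hx => hj'.conj x (hM'M hx),
      ⟨d, ⟨d, hDA hd, rfl⟩, hd0⟩⟩
  have hle := hmin M' _ _ hM'n hM'e (by rw [norm_pow]; exact one_lt_pow₀ hμ hj.ne')
  obtain ⟨h1, h2⟩ := hhl M' M hM'M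
  have h3 := h2 (le_antisymm h1 hle)
  rw [eq_bot_iff]
  intro f hf
  rw [Submodule.mem_bot]
  refine LinearMap.ext fun v => ?_
  obtain ⟨x, rfl⟩ := addAbOf_surjective M v
  obtain ⟨n, hn0, -, hxn⟩ := Subgroup.exists_pow_mem_of_relIndex_ne_zero h3 x.2
  obtain ⟨y, hy, hyx⟩ := hxn.1
  have hy' : y = x ^ n := Subtype.ext hyx
  have h4 := hy f hf
  have h5 : addAbOf (x ^ n) = n • addAbOf x := rfl
  rw [hy', h5, map_nsmul, nsmul_eq_mul] at h4
  exact (mul_eq_zero.1 h4).resolve_left (by exact_mod_cast hn0.ne')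

/-- A finite subset of `M` on which the irreducible homomorphism `ℓ` does not vanish does not cover a
faithful action by its fixed points. -/
theorem IsIrreducibleEigenHom.exists_forall_smul_ne {G : Type*} [Group G] {M : Subgroup G} {t : G}
    {ℓ : G → ℂ} {μ : ℂ} (hirr : IsIrreducibleEigenHom M t ℓ μ) (hM : Group.IsNilpotent M)
    (hfg : M.FG) {X : Type*} [MulAction G X] [FaithfulSMul G X] {P : Set G} (hP : P.Finite)
    (hPM : ∀ p ∈ P, p ∈ M ∧ ℓ p ≠ 0) : ∃ x : X, ∀ p ∈ P, p • x ≠ x := by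
  classical
  obtain ⟨h, hirr⟩ := hirr
  have hfg' : Group.FG M := (Group.fg_iff_subgroup_fg M).2 hfg
  have := finite_addAb M
  have := finite_dual (V := AddAb M) ℚ
  by_contra! hcon
  let c : ℕ → MulAut M := fun e => conjEquiv h.map_conj ^ e
  set N := Module.finrank ℚ (AddAb M →ₗ[ℤ] ℚ)
  -- Every stabilizer contains a member of a finite family of subgroups of `M`, and the annihilators
  -- in this family shrink as `r` grows. The family starts with the cyclic groups generated by `P`.
  have key : ∀ r : ℕ, ∃ 𝓓 : Set (Subgroup M), 𝓓.Finite ∧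
      (∀ D ∈ 𝓓, (∃ d ∈ D, ℓ d ≠ 0) ∧ Module.finrank ℚ (perp D) ≤ N - r) ∧
      ∀ x : X, ∃ D ∈ 𝓓, ∀ d ∈ D, (d : G) • x = x := by
    intro r
    induction r with
    | zero =>
      refine ⟨(fun p : M => Subgroup.zpowers p) '' (Subtype.val ⁻¹' P),
        (hP.preimage Subtype.val_injective.injOn).image _, ?_, ?_⟩
      · rintro _ ⟨p, hp, rfl⟩
        exact ⟨⟨p, Subgroup.mem_zpowers p, (hPM p hp).2⟩, Submodule.finrank_le _⟩
      · intro x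
        obtain ⟨p, hp, hpx⟩ := hcon x
        refine ⟨_, ⟨⟨p, (hPM p hp).1⟩, hp, rfl⟩, ?_⟩
        rintro _ ⟨n, rfl⟩
        have h1 : p ∈ MulAction.stabilizer G x := hpx
        exact (MulAction.stabilizer G x).zpow_mem h1 n
    | succ r ih =>
      obtain ⟨𝓓, hf, h𝓓, hx⟩ := ih
      let m := 𝓓.ncard
      let I : Set (ℕ × ℕ) := {q | q.1 < q.2 ∧ q.2 ≤ m}
      have hI : I.Finite := ((Set.finite_Iic m).prod (Set.finite_Iic m)).subset
        fun q hq => ⟨(hq.1.le.trans hq.2 : q.1 ≤ m), hq.2⟩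
      refine ⟨Set.image2 (fun (q : ℕ × ℕ) (D : Subgroup M) =>
        D.map (c q.1).toMonoidHom ⊔ D.map (c q.2).toMonoidHom) I 𝓓, hI.image2 _ hf, ?_, ?_⟩
      · rintro _ ⟨⟨a, b⟩, ⟨hab, -⟩, D, hD, rfl⟩
        obtain ⟨⟨d, hd, hd0⟩, hrank⟩ := h𝓓 D hD
        have hlt : a < b := hab
        constructor
        · refine ⟨c a d, le_sup_left (a := D.map (c a).toMonoidHom)
            (Subgroup.mem_map_of_mem (c a).toMonoidHom hd), ?_⟩
          rw [coe_conjEquiv_pow, h.conj_pow a d.2]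
          exact mul_ne_zero (pow_ne_zero _ h.eigenvalue_ne_zero) hd0
        · have hsup := perp_sup (D.map (c a).toMonoidHom) (D.map (c b).toMonoidHom)
          change Module.finrank ℚ
            (perp (D.map (c a).toMonoidHom ⊔ D.map (c b).toMonoidHom)) ≤ N - (r + 1)
          rw [hsup]
          set Pa := perp (D.map (c a).toMonoidHom)
          set Pb := perp (D.map (c b).toMonoidHom)
          have ha : Module.finrank ℚ Pa ≤ Module.finrank ℚ (perp D) := finrank_perp_map_le D (c a)
          have hb : Module.finrank ℚ Pb ≤ Module.finrank ℚ (perp D) := finrank_perp_map_le D (c b)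
          -- If the annihilators agree, `perp D` is invariant under the power `b - a`, hence zero by
          -- irreducibility. Otherwise their intersection has smaller dimension than `perp D`.
          by_cases heq : Pa = Pb
          · have h1 : perp (D.map (c (b - a)).toMonoidHom) = perp D := by
              ext f
              obtain ⟨g, rfl⟩ : ∃ g, dualEnd ℚ (addAbEnd (c a).toMonoidHom) g = f :=
                LinearMap.surjective_of_injective (dualEnd_addAbEnd_injective (c a)) f
              rw [← mem_perp_map, ← mem_perp_map, Subgroup.map_map]
              have h2 : (c a).toMonoidHom.comp (c (b - a)).toMonoidHom = (c b).toMonoidHom := by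
                ext v
                have h3 : c b = c a * c (b - a) := by
                  simp only [c]
                  rw [← pow_add]
                  congr 1
                  omega
                rw [h3]
                rfl
              rw [h2]
              change g ∈ Pb ↔ g ∈ Pa
              rw [heq]
            have h4 := hirr D ⟨d, hd, hd0⟩ (b - a) (by omega) h1
            rw [h4, finrank_bot] at ha
            have h5 := Submodule.finrank_mono (inf_le_left : Pa ⊓ Pb ≤ Pa)
            omega
          · have h6 : Module.finrank ℚ ↥(Pa ⊓ Pb) < Module.finrank ℚ (perp D) := by
              rcases (inf_le_left : Pa ⊓ Pb ≤ Pa).lt_or_eq with h7 | h7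
              · exact (Submodule.finrank_lt_finrank_of_lt h7).trans_le ha
              rcases (inf_le_right : Pa ⊓ Pb ≤ Pb).lt_or_eq with h8 | h8
              · exact (Submodule.finrank_lt_finrank_of_lt h8).trans_le hb
              exact absurd (h7.symm.trans h8) heq
            omega
      · intro x
        -- Among the `m + 1` translates of `x` two stabilizers contain the same `D`; conjugating
        -- back, the stabilizer of `x` contains two conjugates of `D`, hence their join.
        choose E hE hEx using fun e : ℕ => hx ((t ^ e)⁻¹ • x)
        obtain ⟨a, ha, b, hb, hab, hEab⟩ : ∃ a ∈ Finset.range (m + 1),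
            ∃ b ∈ Finset.range (m + 1), a ≠ b ∧ E a = E b := by
          refine Finset.exists_ne_map_eq_of_card_lt_of_maps_to (t := hf.toFinset) ?_ ?_
          · rw [← Set.ncard_eq_toFinset_card 𝓓 hf]; simp [m]
          · intro i _; simpa using hE i
        wlog hlt : a < b generalizing a b
        · exact this b hb a ha hab.symm hEab.symm (by omega)
        refine ⟨_, ⟨(a, b), ⟨hlt, Nat.lt_succ_iff.1 (Finset.mem_range.1 hb)⟩, E a, hE a, rfl⟩, ?_⟩
        have hfix : ∀ e, (E e).map (c e).toMonoidHom ≤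
            (MulAction.stabilizer G x).comap M.subtype := by
          rintro e _ ⟨d, hd, rfl⟩
          change ((c e d : M) : G) • x = x
          rw [coe_conjEquiv_pow, mul_smul, mul_smul, hEx e d hd, smul_inv_smul]
        have hsup := sup_le (hfix a) (hEab ▸ hfix b)
        exact fun d hd => hsup hd
  obtain ⟨𝓓, hf, h𝓓, hx⟩ := key N
  have hfin : ∀ D ∈ 𝓓, D.FiniteIndex := by
    intro D hD
    refine finiteIndex_of_perp_eq_bot ?_
    have h1 := (h𝓓 D hD).2
    rw [Nat.sub_self, Nat.le_zero] at h1
    exact Submodule.finrank_eq_zero.1 h1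
  have : Finite 𝓓 := hf
  -- The intersection of the family fixes every point, so it is trivial by faithfulness; but it has
  -- finite index in `M`, which has an element of infinite order because `ℓ ≠ 0`.
  have hI : (⨅ D : 𝓓, (D : Subgroup M)).FiniteIndex :=
    Subgroup.finiteIndex_iInf fun D => hfin D D.2
  have hbot : (⨅ D : 𝓓, (D : Subgroup M)) = ⊥ := by
    rw [eq_bot_iff]
    intro d hd
    have h1 : (d : G) = 1 := FaithfulSMul.eq_of_smul_eq_smul (α := X) fun x => by
      obtain ⟨D, hD, hDx⟩ := hx x
      rw [one_smul]
      exact hDx d (Subgroup.mem_iInf.1 hd ⟨D, hD⟩)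
    exact Subtype.ext h1
  rw [hbot] at hI
  obtain ⟨v, hv, hv0⟩ := h.exists_ne_zero
  obtain ⟨n, hn, -, hvn⟩ := Subgroup.exists_pow_mem_of_index_ne_zero hI.index_ne_zero (⟨v, hv⟩ : M)
  have h2 : v ^ n = 1 := congrArg Subtype.val (Subgroup.mem_bot.1 hvn)
  have h3 := h.map_pow hv n
  rw [h2, h.map_one] at h3
  exact (mul_ne_zero (by exact_mod_cast hn.ne') hv0) h3.symm

/-! ## Exponential growth -/

/-- The product `v ^ ε₀ * φ (v ^ ε₁) * ⋯ * φⁿ⁻¹ (v ^ εₙ₋₁)`, where `φ` is the conjugation by `t` and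
the `εᵢ` are the binary digits of `k`. -/
def digitProd {G : Type*} [Group G] (t v : G) : ℕ → ℕ → G
  | 0, _ => 1
  | n + 1, k => v ^ (k % 2) * (t * digitProd t v n (k / 2) * t⁻¹)

/-- The conjugations telescope: the product is `(v ^ ε₀ * t) * (v ^ ε₁ * t) * ⋯`, a word of length
`n`. -/
theorem digitProd_mul_pow_mem {G : Type*} [Group G] (t v : G) (n k : ℕ) :
    digitProd t v n k * t ^ n ∈ ({t, v * t} : Set G) ^ n := by
  induction n generalizing k with
  | zero => simp [digitProd]
  | succ n ih =>
    have h1 : digitProd t v (n + 1) k * t ^ (n + 1) =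
        (v ^ (k % 2) * t) * (digitProd t v n (k / 2) * t ^ n) := by
      rw [digitProd, pow_succ']; group
    rw [h1, pow_succ']
    refine Set.mul_mem_mul ?_ (ih _)
    rcases Nat.mod_two_eq_zero_or_one k with h | h <;> simp [h]

namespace IsEigenHom

variable {G : Type*} [Group G] {M : Subgroup G} {t v : G} {ℓ : G → ℂ} {μ : ℂ}

theorem digitProd_mem (h : IsEigenHom M t ℓ μ) (hv : v ∈ M) (n k : ℕ) : digitProd t v n k ∈ M := by
  induction n generalizing k with
  | zero => exact M.one_mem
  | succ n ih => exact M.mul_mem (M.pow_mem hv _) (h.conj_mem (ih _))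

theorem apply_digitProd_succ (h : IsEigenHom M t ℓ μ) (hv : v ∈ M) (n k : ℕ) :
    ℓ (digitProd t v (n + 1) k) = (k % 2 : ℕ) * ℓ v + μ * ℓ (digitProd t v n (k / 2)) := by
  rw [digitProd, h.map_mul _ (M.pow_mem hv _) _ (h.conj_mem (h.digitProd_mem hv n _)),
    h.map_pow hv, h.conj _ (h.digitProd_mem hv n _)]

/-- Induction on the lowest digit of `∑ εᵢ μ ^ i`. If the higher digits agree, the difference is `±ℓ
v`. Otherwise they contribute at least `2 * ‖ℓ v‖`, and the lowest digit cancels at most `‖ℓ v‖`. -/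
theorem norm_le_norm_sub_digitProd (h : IsEigenHom M t ℓ μ) (hμ : 2 ≤ ‖μ‖) (hv : v ∈ M) (n : ℕ) :
    ∀ j < 2 ^ n, ∀ k < 2 ^ n, j ≠ k →
      ‖ℓ v‖ ≤ ‖ℓ (digitProd t v n j) - ℓ (digitProd t v n k)‖ := by
  induction n with
  | zero => intro j hj k hk hjk; omega
  | succ n ih =>
    intro j hj k hk hjk
    rw [h.apply_digitProd_succ hv, h.apply_digitProd_succ hv]
    set a := ℓ (digitProd t v n (j / 2))
    set b := ℓ (digitProd t v n (k / 2))
    have hsub : ((j % 2 : ℕ) : ℂ) * ℓ v + μ * a - (((k % 2 : ℕ) : ℂ) * ℓ v + μ * b) =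
        μ * (a - b) - (((k % 2 : ℕ) : ℂ) - ((j % 2 : ℕ) : ℂ)) * ℓ v := by ring
    rw [hsub]
    by_cases hjk2 : j / 2 = k / 2
    · have hab : a = b := by simp only [a, b, hjk2]
      rw [hab, sub_self, mul_zero, zero_sub, norm_neg, norm_mul]
      have h1 : ‖((k % 2 : ℕ) : ℂ) - ((j % 2 : ℕ) : ℂ)‖ = 1 := by
        rcases Nat.mod_two_eq_zero_or_one k with h2 | h2 <;>
          rcases Nat.mod_two_eq_zero_or_one j with h3 | h3
        · omega
        · simp [h2, h3]
        · simp [h2, h3]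
        · omega
      rw [h1, one_mul]
    · have h1 := ih (j / 2) (by omega) (k / 2) (by omega) hjk2
      have h2 : ‖((k % 2 : ℕ) : ℂ) - ((j % 2 : ℕ) : ℂ)‖ ≤ 1 := by
        rcases Nat.mod_two_eq_zero_or_one k with h2 | h2 <;>
          rcases Nat.mod_two_eq_zero_or_one j with h3 | h3 <;> simp [h2, h3]
      have h3 := norm_sub_norm_le (μ * (a - b)) ((((k % 2 : ℕ) : ℂ) - ((j % 2 : ℕ) : ℂ)) * ℓ v)
      rw [norm_mul, norm_mul] at h3
      have h4 : 2 * ‖ℓ v‖ ≤ ‖μ‖ * ‖a - b‖ := mul_le_mul hμ h1 (norm_nonneg _) (norm_nonneg _)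
      have h5 := mul_le_mul_of_nonneg_right h2 (norm_nonneg (ℓ v))
      linarith

end IsEigenHom

/-- Polycyclic groups that are not virtually nilpotent have exponential growth in every faithful
action. -/
theorem IsPolycyclic.growthLE_exp {G : Type*} [Group G] (hG : IsPolycyclic G)
    (hv : ¬ Group.IsVirtuallyNilpotent G) {X : Type*} [Nonempty X] [MulAction G X]
    [FaithfulSMul G X] {S : Set G} (hSf : S.Finite) (hS : Subgroup.closure S = ⊤) :
    GrowthLE (fun n => Real.exp n) fun n => (actionGrowth S X n : ℝ) := by
  obtain ⟨M, t, ℓ, μ, hM, hirr, hμ⟩ := hG.exists_isIrreducibleEigenHom hv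
  obtain ⟨h, -⟩ := id hirr
  obtain ⟨k, hk⟩ := pow_unbounded_of_one_lt 2 hμ
  have hk' : 2 ≤ ‖μ ^ k‖ := by rw [norm_pow]; exact hk.le
  obtain ⟨v, hvM, hv0⟩ := h.exists_ne_zero
  have h' := h.pow k
  set s := t ^ k
  obtain ⟨r, hr0, hr⟩ := exists_le_actionGrowth (X := X) hSf hS (B := {s, v * s})
    (f := fun n => 2 ^ n) (Set.toFinite _) (by
      intro n
      let W := digitProd s v n
      let J : Set ℕ := Set.Iio (2 ^ n)
      have hJ : J.Finite := Set.finite_Iio _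
      obtain ⟨x, hx⟩ := hirr.exists_forall_smul_ne hM (hG.subgroup_fg M) (X := X)
        (P := (fun q : ℕ × ℕ => (W q.1)⁻¹ * W q.2) '' ((J ×ˢ J) \ {q | q.1 = q.2}))
        (((hJ.prod hJ).sdiff).image _) (by
          rintro _ ⟨⟨a, b⟩, ⟨⟨ha, hb⟩, hab⟩, rfl⟩
          have ha' := h'.digitProd_mem hvM n a
          have hb' := h'.digitProd_mem hvM n b
          refine ⟨M.mul_mem (M.inv_mem ha') hb', fun h0 => ?_⟩
          dsimp only at h0
          rw [h'.map_mul _ (M.inv_mem ha') _ hb', h'.map_inv ha', neg_add_eq_sub] at h0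
          have h1 := h'.norm_le_norm_sub_digitProd hk' hvM n b hb a ha (fun h2 => hab h2.symm)
          rw [h0, norm_zero, norm_le_zero_iff] at h1
          exact hv0 h1)
      -- The short words are `W j * s ^ n`; this base point makes them hit `W j • x`.
      refine ⟨(s ^ n)⁻¹ • x, ?_⟩
      have hinj : Set.InjOn (fun j => W j • x) J := by
        intro a ha b hb hab
        by_contra hne
        refine hx _ ⟨(a, b), ⟨⟨ha, hb⟩, hne⟩, rfl⟩ ?_
        rw [mul_smul, inv_smul_eq_iff]
        exact hab.symm
      have hJc : J.ncard = 2 ^ n := by simp [J]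
      rw [← hJc, ← hinj.ncard_image]
      refine Set.ncard_le_ncard ?_ (((Set.toFinite _).group_pow n).image _)
      rintro _ ⟨j, -, rfl⟩
      refine ⟨W j * s ^ n, digitProd_mul_pow_mem s v n j, ?_⟩
      dsimp only
      rw [mul_smul, smul_inv_smul])
  -- The factor `2` passes from base `2` to base `4`, which exceeds `e`.
  refine ⟨r * 2, by omega, Filter.Eventually.of_forall fun n => ?_⟩
  have h1 : ((2 ^ (2 * n) : ℕ) : ℝ) ≤ (actionGrowth S X (r * (2 * n)) : ℝ) := by
    exact_mod_cast hr (2 * n)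
  have h2 : Real.exp n ≤ ((2 ^ (2 * n) : ℕ) : ℝ) := by
    have h3 : Real.exp 1 ≤ 4 := by linarith [Real.exp_one_lt_d9]
    have h4 : Real.exp n = Real.exp 1 ^ n := by rw [← Real.exp_nat_mul, mul_one]
    rw [h4, pow_mul]
    push_cast
    refine pow_le_pow_left₀ (Real.exp_pos 1).le ?_ n
    linarith
  have h5 : (1 : ℝ) ≤ (r * 2 : ℕ) := by exact_mod_cast (by omega : 1 ≤ r * 2)
  rw [← mul_assoc] at h1
  exact (h2.trans h1).trans (le_mul_of_one_le_left (Nat.cast_nonneg _) h5)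

theorem mainTheorem8 :
    (∀ (G : Type u) [Group G], IsPolycyclic G → ¬ Group.IsVirtuallyNilpotent G →
      HasSchreierGrowthGap.{u, w} G fun n => Real.exp n) ∧
    (∀ (G : Type u) [Group G] [Group.FG G], Group.IsVirtuallyNilpotent G →
      ¬ IsVirtuallyAbelian G →
        (∃ H : Subgroup G, Nonempty (H ≃* heisenbergGroup)) ∧
        (∀ H : Subgroup G, Nonempty (H ≃* heisenbergGroup) →
          IsNonFoldable.{u, w} (H : Set G)) ∧
        HasSchreierGrowthGap.{u, w} G fun n => (n : ℝ) ^ 4) := by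
  refine ⟨fun G _ hG hv => ⟨⟨hG.subgroup_fg ⊤⟩, fun X _ _ _ S hSf hS => hG.growthLE_exp hv hSf hS⟩,
    fun G _ hfg hG hab => ?_⟩
  have hex := exists_heisenberg_of_not_isVirtuallyAbelian hG hab
  refine ⟨hex, fun H ⟨e⟩ X _ _ _ => isNonFoldedIn_of_mulEquiv_heisenbergGroup e X, hfg, ?_⟩
  intro X _ _ _ S hSf hS
  obtain ⟨H, ⟨e⟩⟩ := hex
  exact growthLE_of_mulEquiv_heisenbergGroup e hSf hS
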